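/- **Definitions.** Let $m$ be the normalized Haar measure on the infinite polytorus $\mathbb T^\infty$ (one coordinate for each prime), regarded as the group of completely multiplicative $\chi:\mathbb N_{\ge1}\to\mathbb T$. For a Dirichlet polynomial $P(s)=\sum a_n n^{-s}$ (a finite sum over $n\ge 1$), a real $p\ge1$ and $\sigma>0$, put $P_\sigma(s)=P(s+\sigma)$ and $$\|P\|_{\mathcal H^p}^p=\int_{\mathbb T^\infty}\Big|\sum a_n\chi(n)\Big|^p\,dm(\chi).$$ Let $\mu$ be a probability measure on $(0,+\infty)$ with $0\in\operatorname{Supp}\mu$. The space $\mathcal A^p_\mu$ is the completion of the Dirichlet polynomials for the norm $$\|P\|_{\mathcal A^p_\mu}=\Big(\int_0^{+\infty}\|P_\sigma\|_{\mathcal H^p}^p\,d\mu(\sigma)\Big)^{1/p};$$ its elements are identified with Dirichlet series (coefficientwise limits), and $\mathcal A^p_{\mu,\infty}$ is its subspace of series whose constant coefficient $a_1$ is $0$. The space $\mathcal D^p_\mu$ consists of the Dirichlet series $f=\sum_{n\ge1}a_n n^{-s}$, convergent in some half-plane, with $$\|f\|_{\mathcal D^p_\mu}^p=|f(+\infty)|^p+\|f'\|^p_{\mathcal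 A^p_\mu}<+\infty,\qquad f(+\infty)=a_1.$$ A Dirichlet series is also viewed as the holomorphic function it represents; its value $f(s)$ at a point $s$ of $\mathbb C_{1/2}=\{s\in\mathbb C:\operatorname{Re}s>1/2\}$ is the value of its holomorphic extension to $\mathbb C_{1/2}$. $\|\delta_s\|_{X^*}$ denotes the norm of the evaluation $f\mapsto f(s)$ on a space $X$. For $\alpha>-1$ write $\mathcal D^p_\alpha=\mathcal D^p_{\mu_\alpha}$, where $d\mu_\alpha(\sigma)=\frac{2^{\alpha+1}}{\Gamma(\alpha+1)}\sigma^\alpha e^{-2\sigma}\,d\sigma$ on $(0,+\infty)$. **Theorem.** (1) Let $p\ge1$, $1/p+1/p'=1$, and let $\mu$ be a probability measure on $(0,+\infty)$ with $0\in\operatorname{Supp}\mu$. Every $f\in\mathcal D^p_\mu$ extends holomorphically to $\mathbb C_{1/2}$, and for every $s\in\mathbb C_{1/2}$ $$|f(s)|\le 2^{1/p'}\max\Big(1,\int_{\operatorname{Re}s}^{+\infty}\|\delta_t\|_{(\mathcal A^p_{\mu,\infty})^*}\,dt\Big)\,\|f\|_{\mathcal D^p_\mu}.$$ (2) Let $p\ge1$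 and $\alpha>-1$. There is a constant $c_{p,\alpha}>0$ such that for every $s\in\mathbb C_{1/2}$ $$\|\delta_s\|_{(\mathcal D^p_\alpha)^*}\le\begin{cases}c_{p,\alpha}\max\big(1,(2\operatorname{Re}s-1)^{1-(2+\alpha)/p}\big)&\text{if }\alpha>p-2,\\[2pt] c_{p,\alpha}\max\Big(1,\log\dfrac1{2\operatorname{Re}s-1}\Big)&\text{if }\alpha=p-2,\\[2pt] c_{p,\alpha}&\text{if }\alpha<p-2.\end{cases}$$ -/

import Mathlib

open MeasureTheory Filter Topology Set
open scoped ENNReal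

noncomputable section

/-- Dirichlet polynomials `∑ aₙ n^{-s}`, given by their coefficients. -/
abbrev DirichletPoly : Type := ℕ+ →₀ ℂ

/-- The infinite-dimensional polytorus, with one coordinate for each prime number. -/
abbrev Polytorus : Type := Nat.Primes → UnitAddCircle

/-- The normalized Haar measure of the polytorus. -/
def polytorusHaar : Measure Polytorus :=
  Measure.infinitePi fun _ : Nat.Primes => (AddCircle.haarAddCircle : Measure UnitAddCircle)

/-- The character `χ(n) = ∏ χ(q)^{v_q(n)}` attached to a point of the polytorus
(the monomial `z₁^{α₁} ⋯ z_k^{α_k}` of the Bohr correspondence). -/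
def bohrChar (χ : Polytorus) (n : ℕ+) : ℂ :=
  ∏ q ∈ (n : ℕ).primeFactors.attach,
    ((AddCircle.toCircle (χ ⟨q.1, Nat.prime_of_mem_primeFactors q.2⟩) : Circle) : ℂ)
      ^ (n : ℕ).factorization q.1

/-- The Bohr lift of a Dirichlet polynomial to an analytic polynomial on the polytorus. -/
def bohrLift (P : DirichletPoly) (χ : Polytorus) : ℂ :=
  P.sum fun n c => c * bohrChar χ n

/-- The norm of a Dirichlet polynomial in the Hardy space `H^p`. -/
def hardyNorm (p : ℝ) (P : DirichletPoly) : ℝ≥0∞ :=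
  eLpNorm (bohrLift P) (ENNReal.ofReal p) polytorusHaar

/-- The translate `P_σ(s) = P(σ + s)`. -/
def dirichletTranslate (σ : ℝ) (P : DirichletPoly) : DirichletPoly :=
  P.sum fun n c => Finsupp.single n (c * ((n : ℕ) : ℂ) ^ (-(σ : ℂ)))

/-- The norm of a Dirichlet polynomial in the Bergman space `A^p_μ`. -/
def bergmanPolyNorm (p : ℝ) (μ : Measure ℝ) (P : DirichletPoly) : ℝ≥0∞ :=
  (∫⁻ σ, hardyNorm p (dirichletTranslate σ P) ^ p ∂μ) ^ (1 / p)

/-- The sequence of Dirichlet polynomials `P k` is Cauchy for the norm of `A^p_μ`, and its limit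
in the completion is the Dirichlet series with coefficients `b n`, `n ≥ 1`
(the value `b 0` is irrelevant). -/
def IsBergmanLimit (p : ℝ) (μ : Measure ℝ) (P : ℕ → DirichletPoly) (b : ℕ → ℂ) : Prop :=
  (∀ ε : ℝ≥0∞, 0 < ε → ∃ K, ∀ j ≥ K, ∀ k ≥ K, bergmanPolyNorm p μ (P j - P k) ≤ ε) ∧
    ∀ n : ℕ+, Tendsto (fun k => P k n) atTop (𝓝 (b n))

/-- The norm in `A^p_μ`, the completion of the Dirichlet polynomials, of the Dirichlet series with
coefficients `b`; it is `∞` when the series does not belong to `A^p_μ`. -/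
def bergmanNorm (p : ℝ) (μ : Measure ℝ) (b : ℕ → ℂ) : ℝ≥0∞ :=
  ⨅ (P : ℕ → DirichletPoly) (_ : IsBergmanLimit p μ P b),
    liminf (fun k => bergmanPolyNorm p μ (P k)) atTop

/-- The space `A^p_{μ,∞}` of the elements of `A^p_μ` with vanishing constant coefficient. -/
def bergmanSpaceInfty (p : ℝ) (μ : Measure ℝ) : Set (ℕ → ℂ) :=
  {b | b 1 = 0 ∧ bergmanNorm p μ b < ∞}

/-- The coefficients `-(log n) aₙ` of the derivative of a Dirichlet series. -/
def derivCoeff (a : ℕ → ℂ) : ℕ → ℂ := -LSeries.logMul a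

/-- The norm of the Dirichlet space `D^p_μ`: `‖f‖^p = |f(+∞)|^p + ‖f'‖^p`, where `f(+∞) = a₁`. -/
def dirichletNorm (p : ℝ) (μ : Measure ℝ) (a : ℕ → ℂ) : ℝ≥0∞ :=
  (‖a 1‖ₑ ^ p + bergmanNorm p μ (derivCoeff a) ^ p) ^ (1 / p)

/-- The Dirichlet space `D^p_μ`: the Dirichlet series which converge in some half-plane
and have finite norm. -/
def dirichletSpace (p : ℝ) (μ : Measure ℝ) : Set (ℕ → ℂ) :=
  {a | LSeries.abscissaOfAbsConv a < ⊤ ∧ dirichletNorm p μ a < ∞}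

/-- `f` is, on the half-plane `Re s > 1/2`, the holomorphic function which is represented by the
Dirichlet series with coefficients `a`: the series converges in some half-plane, and `f` is
its (necessarily unique) holomorphic extension to `Re s > 1/2`. -/
def IsFunctionOf (a : ℕ → ℂ) (f : ℂ → ℂ) : Prop :=
  LSeries.abscissaOfAbsConv a < ⊤ ∧ DifferentiableOn ℂ f {s : ℂ | 1 / 2 < s.re} ∧
    ∀ s : ℂ, 1 / 2 < s.re → LSeries.abscissaOfAbsConv a < s.re → f s = LSeries a s

/-- The norm of the point evaluation `f ↦ f(s)` on a space `V` of Dirichlet series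
with norm `N`. -/
def evalNorm (V : Set (ℕ → ℂ)) (N : (ℕ → ℂ) → ℝ≥0∞) (s : ℂ) : ℝ≥0∞ :=
  ⨆ (a : ℕ → ℂ) (f : ℂ → ℂ) (_ : a ∈ V) (_ : N a ≤ 1) (_ : IsFunctionOf a f), ‖f s‖ₑ

/-- The norm of the evaluation at `s` on `A^p_{μ,∞}`. -/
def bergmanInftyEvalNorm (p : ℝ) (μ : Measure ℝ) (s : ℂ) : ℝ≥0∞ :=
  evalNorm (bergmanSpaceInfty p μ) (bergmanNorm p μ) s

/-- The norm of the evaluation at `s` on `D^p_μ`. -/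
def dirichletEvalNorm (p : ℝ) (μ : Measure ℝ) (s : ℂ) : ℝ≥0∞ :=
  evalNorm (dirichletSpace p μ) (dirichletNorm p μ) s

/-- The probability measure `2^{α+1} / Γ(α+1) · σ^α e^{-2σ} dσ` on `(0, ∞)`. -/
def muAlpha (α : ℝ) : Measure ℝ :=
  volume.withDensity fun σ => ENNReal.ofReal
    (if 0 < σ then 2 ^ (α + 1) / Real.Gamma (α + 1) * σ ^ α * Real.exp (-2 * σ) else 0)

end

/-! The derivative `f'` lies in `A^p_{μ,∞}`, its constant coefficient being `0`, and `f(σ + iy)`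
tends to `a₁` as `σ → +∞`. Hence `f(s)` is `a₁` minus the integral of `f'` along the horizontal
half-line to the right of `s`. Bounding `f'` by point evaluations on `A^p_{μ,∞}` gives (1), and (2)
follows by estimating those evaluations for `μ_α` and integrating.

Evaluations are estimated from `H^p` upwards. On the circle, a Poisson kernel times a power of `1 -
w̄z` reproduces analytic polynomials at `w`, and Hölder gives the constant `(1 - |w|²)^{-1/p}`
(`exists_circle_kernel`). Products of such kernels over finitely many primes, taken at `w_q =
q^{-s}`, turn these constants into an Euler product, so that evaluation at `s` on `H^p` costs at
most `ζ(2 Re s)^{1/p}` (`enorm_dirichletEval_le_hardyNorm`). Averaging over the shifts `σ` in `(0,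
ε)`, a set of positive measure since `0` is in the support, gives the bound `(ζ(1 + 2ε) / μ(0,
ε))^{1/p}` on `A^p_μ` when `Re s ≥ 1/2 + 2ε` (`enorm_dirichletEval_le`). It makes Cauchy sequences
of polynomials converge locally uniformly on `Re s > 1/2`, which provides the holomorphic extension
(`IsBergmanLimit.exists_isFunctionOf`).

The norm of an evaluation depends on `Re s` only, because vertical translations act as rotations of
the polytorus. For `μ_α` the pole of `ζ` and `μ_α(0, ε) ≳ ε^{α+1}` yield `(2t - 1)^{-(2+α)/p}` near
`1/2`, while the vanishing constant coefficient yields decay like `2^{-t}` at infinity. The three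
cases of (2) are those of `∫ u^{-(2+α)/p} du` near `0`. -/

/-! ### Reproducing kernels and orthogonality on the circle. -/

/-- The complex number of modulus one which corresponds to a point of the circle. -/
noncomputable def circleVal (x : UnitAddCircle) : ℂ := ((AddCircle.toCircle x : Circle) : ℂ)

theorem continuous_circleVal : Continuous circleVal :=
  continuous_subtype_val.comp AddCircle.continuous_toCircle

theorem norm_circleVal (x : UnitAddCircle) : ‖circleVal x‖ = 1 := Circle.norm_coe _

/-- Integrals against the normalized Haar measure of the circle are circle averages. -/
theorem integral_haarAddCircle_eq_circleAverage (F : ℂ → ℂ) :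
    ∫ x : UnitAddCircle, F (circleVal x) ∂AddCircle.haarAddCircle
      = Real.circleAverage F 0 1 := by
  rw [AddCircle.integral_haarAddCircle, ← UnitAddCircle.intervalIntegral_preimage 0,
    Real.circleAverage_def]
  have h := intervalIntegral.integral_comp_mul_left (a := 0) (b := 1) (c := 2 * Real.pi)
    (fun θ => F (circleMap 0 1 θ)) (by positivity)
  simp only [mul_zero, mul_one] at h
  rw [← h]
  simp [circleVal, AddCircle.toCircle_apply_mk, circleMap, mul_comm]

theorem norm_sub_eq_norm_one_sub_conj_mul {z w : ℂ} (hz : ‖z‖ = 1) :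
    ‖z - w‖ = ‖1 - starRingEnd ℂ w * z‖ := by
  have h : z * starRingEnd ℂ z = 1 := by simp [Complex.mul_conj', hz]
  calc ‖z - w‖ = ‖starRingEnd ℂ (z - w) * z‖ := by rw [norm_mul, RCLike.norm_conj, hz, mul_one]
    _ = _ := by
      congr 1
      rw [map_sub, sub_mul, mul_comm (starRingEnd ℂ z), h]

/-- The reproducing kernel of the Hardy space of the disc at `w`, adapted to the exponent `p`. -/
theorem exists_circle_kernel (p : ℝ) {w : ℂ} (hw : ‖w‖ < 1) :
    ∃ (K : UnitAddCircle → ℂ) (W : UnitAddCircle → ℝ), Continuous K ∧ Continuous W ∧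
      (∀ x, 0 ≤ W x) ∧ ∫ x, W x ∂AddCircle.haarAddCircle = 1 ∧
      (∀ x, ‖K x‖ = ((1 - ‖w‖ ^ 2)⁻¹) ^ (1 / p) * W x ^ (1 - 1 / p)) ∧
      ∀ k : ℕ, ∫ x, K x * (circleVal x) ^ k ∂AddCircle.haarAddCircle = w ^ k := by
  have hw2 : 0 < 1 - ‖w‖ ^ 2 := by nlinarith [norm_nonneg w]
  -- The exponent `2 / p` makes `|h|` the `(-1/p)`-th power of the Poisson kernel on the circle, up
  -- to a constant, so that the kernel times `h / h(w)` has modulus a constant times its `(1 -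
  -- 1/p)`-th power. The base has positive real part on the closed disc, so the principal branch is
  -- holomorphic there.
  set h : ℂ → ℂ := fun z => (1 - starRingEnd ℂ w * z) ^ ((2 / p : ℝ) : ℂ) with hh
  have hre : ∀ z : ℂ, ‖z‖ ≤ 1 → 0 < (1 - starRingEnd ℂ w * z).re := by
    intro z hz
    have h1 : (starRingEnd ℂ w * z).re ≤ ‖w‖ * 1 := by
      refine (Complex.re_le_norm _).trans ?_
      rw [norm_mul, RCLike.norm_conj]
      gcongr
    simp only [Complex.sub_re, Complex.one_re]
    linarith
  have hmem : ∀ z : ℂ, ‖z‖ ≤ 1 → 1 - starRingEnd ℂ w * z ∈ Complex.slitPlane := fun z hz =>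
    Or.inl (hre z hz)
  have hhw : h w = (((1 - ‖w‖ ^ 2) ^ (2 / p) : ℝ) : ℂ) := by
    simp only [hh]
    rw [mul_comm, Complex.mul_conj', Complex.ofReal_cpow hw2.le]
    push_cast
    rfl
  have hhw0 : h w ≠ 0 := by
    rw [hhw]
    exact_mod_cast (Real.rpow_pos_of_pos hw2 _).ne'
  have hdiff : ∀ k : ℕ, DiffContOnCl ℂ (fun z => h z / h w * z ^ k) (Metric.ball 0 1) := by
    intro k
    apply DifferentiableOn.diffContOnCl
    rw [closure_ball _ one_ne_zero]
    intro z hz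
    have hz' : ‖z‖ ≤ 1 := by simpa using hz
    refine DifferentiableAt.differentiableWithinAt ?_
    refine DifferentiableAt.mul (DifferentiableAt.div_const ?_ _) (by fun_prop)
    exact DifferentiableAt.cpow_const (by fun_prop) (hmem z hz')
  have hc := continuous_circleVal
  have hn := norm_circleVal
  have hne : ∀ x : UnitAddCircle, (circleVal x) - w ≠ 0 := by
    intro x hx
    rw [sub_eq_zero] at hx
    have := hn x
    rw [hx] at this
    linarith
  have hW : Continuous fun x : UnitAddCircle =>
      poissonKernel 0 w (circleVal x) := by
    simp only [poissonKernel_def, sub_zero]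
    refine Continuous.div (by fun_prop) (by fun_prop) fun x => ?_
    simpa using hne x
  have hWpos : ∀ x : UnitAddCircle, poissonKernel 0 w (circleVal x)
      = (1 - ‖w‖ ^ 2) / ‖1 - starRingEnd ℂ w * (circleVal x)‖ ^ 2 := by
    intro x
    rw [poissonKernel_def, ← norm_sub_eq_norm_one_sub_conj_mul (hn x)]
    simp [hn x]
  have hrep : ∀ k : ℕ, ∫ x : UnitAddCircle, ((poissonKernel 0 w (circleVal x) : ℂ)
      * (h (circleVal x) / h w)) * (circleVal x) ^ k
        ∂AddCircle.haarAddCircle = w ^ k := by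
    intro k
    have h1 := (hdiff k).circleAverage_poissonKernel_smul (w := w) (by simpa using hw)
    rw [div_self hhw0, one_mul] at h1
    rw [← h1, ← integral_haarAddCircle_eq_circleAverage]
    simp [mul_assoc]
  refine ⟨fun x => (poissonKernel 0 w (circleVal x) : ℂ)
      * (h (circleVal x) / h w),
    fun x => poissonKernel 0 w (circleVal x), ?_, hW, ?_, ?_, ?_, hrep⟩
  · refine (Complex.continuous_ofReal.comp hW).mul (Continuous.div_const ?_ _)
    exact Continuous.cpow (by fun_prop) continuous_const fun x => hmem _ (hn x).le
  · intro x
    simp only [hWpos]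
    positivity
  -- The Poisson kernel has mass one: it reproduces the constant function `1`.
  · have h1 := (DifferentiableOn.diffContOnCl (f := fun _ : ℂ => (1 : ℂ)) (𝕜 := ℂ)
      (s := Metric.ball 0 1) (by fun_prop)).circleAverage_poissonKernel_smul
      (w := w) (by simpa using hw)
    rw [← integral_haarAddCircle_eq_circleAverage] at h1
    simp only [Pi.smul_apply', Complex.real_smul, mul_one] at h1
    rw [integral_complex_ofReal] at h1
    exact_mod_cast h1
  · intro x
    have hpos : 0 < ‖1 - starRingEnd ℂ w * (circleVal x)‖ := by
      rw [← norm_sub_eq_norm_one_sub_conj_mul (hn x)]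
      simpa using hne x
    set A := 1 - ‖w‖ ^ 2
    set B := ‖1 - starRingEnd ℂ w * circleVal x‖
    have hB : ‖h (circleVal x)‖ = B ^ (2 / p) := by
      simp only [hh, B]
      rw [Complex.norm_cpow_real]
    have hWx : poissonKernel 0 w (circleVal x) = A / B ^ 2 := hWpos x
    have hA : ‖h w‖ = A ^ (2 / p) := by
      rw [hhw, Complex.norm_real, Real.norm_of_nonneg (Real.rpow_nonneg hw2.le _)]
    simp only [norm_mul, Complex.norm_real, hWx]
    rw [norm_div (h _), hA, hB, Real.norm_of_nonneg (show 0 ≤ A / B ^ 2 by positivity),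
      Real.inv_rpow hw2.le, Real.div_rpow hw2.le (by positivity), Real.rpow_sub hw2,
      ← Real.rpow_natCast B 2, ← Real.rpow_mul hpos.le, mul_sub, Real.rpow_sub hpos,
      show 2 / p = 1 / p + 1 / p by ring, Real.rpow_add hw2, Real.rpow_one]
    have e : ((2 : ℕ) : ℝ) * (1 / p) = 1 / p + 1 / p := by push_cast; ring
    have := Real.rpow_pos_of_pos hw2 (1 / p)
    have := Real.rpow_pos_of_pos hpos (1 / p + 1 / p)
    rw [e, mul_one]
    field_simp

theorem integral_circleVal_pow_mul_conj_pow (k l : ℕ) :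
    ∫ x, circleVal x ^ k * starRingEnd ℂ (circleVal x) ^ l ∂AddCircle.haarAddCircle
      = if k = l then 1 else 0 := by
  have h : ∀ x, circleVal x ^ k * starRingEnd ℂ (circleVal x) ^ l
      = (fun z : ℂ => z ^ ((k : ℤ) - l)) (circleVal x) := by
    intro x
    have h0 : circleVal x ≠ 0 := norm_ne_zero_iff.1 (by simp [norm_circleVal])
    have h1 : starRingEnd ℂ (circleVal x) = (circleVal x)⁻¹ := by
      rw [eq_comm, inv_eq_iff_eq_inv, ← mul_eq_one_iff_eq_inv₀ (by simpa using h0),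
        Complex.mul_conj']
      simp [norm_circleVal]
    simp only [h1]
    rw [zpow_sub₀ h0]
    simp [div_eq_mul_inv]
  simp only [h]
  rw [integral_haarAddCircle_eq_circleAverage (fun z : ℂ => z ^ ((k : ℤ) - l))]
  split_ifs with hkl
  · simp [hkl, Real.circleAverage_const]
  · rw [Real.circleAverage_eq_circleIntegral one_ne_zero]
    have h2 : ∮ z in C(0, 1), (z - 0)⁻¹ • z ^ ((k : ℤ) - l)
        = ∮ z in C(0, 1), (z - 0) ^ ((k : ℤ) - l - 1) := by
      refine circleIntegral.integral_congr zero_le_one fun z hz => ?_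
      have hz0 : z ≠ 0 := norm_ne_zero_iff.1 (by simp_all)
      simp only [sub_zero, smul_eq_mul]
      rw [zpow_sub_one₀ hz0, mul_comm]
    rw [h2, circleIntegral.integral_sub_zpow_of_ne (by omega), smul_zero]

/-! ### Integration on the polytorus and point evaluations on `H^p`. -/

instance : IsProbabilityMeasure polytorusHaar := by
  unfold polytorusHaar
  infer_instance

theorem integral_polytorusHaar_prod {𝕜 : Type*} [RCLike 𝕜] (S : Finset Nat.Primes)
    {φ : Nat.Primes → UnitAddCircle → 𝕜} (hφ : ∀ q, Continuous (φ q)) :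
    ∫ χ, ∏ q ∈ S, φ q (χ q) ∂polytorusHaar
      = ∏ q ∈ S, ∫ x, φ q x ∂AddCircle.haarAddCircle := by
  have h := (ProbabilityTheory.iIndepFun_infinitePi
    (P := fun _ : Nat.Primes => (AddCircle.haarAddCircle : Measure UnitAddCircle))
    (X := φ) fun q => (hφ q).measurable).precomp (Subtype.val_injective (p := (· ∈ S)))
  have h2 := h.integral_fun_prod_eq_prod_integral fun q =>
    ((hφ q).measurable.comp (measurable_pi_apply q.1)).aestronglyMeasurable
  have h3 : ∀ q, ∫ χ : Polytorus, φ q (χ q) ∂polytorusHaar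
      = ∫ x, φ q x ∂AddCircle.haarAddCircle := by
    intro q
    have := (measurePreserving_eval_infinitePi
      (fun _ : Nat.Primes => (AddCircle.haarAddCircle : Measure UnitAddCircle)) q)
    rw [← this.map_eq, integral_map this.measurable.aemeasurable
      (hφ q).measurable.aestronglyMeasurable]
    rfl
  simp only [← h3, ← Finset.prod_coe_sort S]
  exact h2

/-- Hölder with exponents `1/p` and `1 - 1/p` applied to `|F|^p` and the probability density `W`;
this form includes `p = 1`. -/
theorem enorm_integral_kernel_mul_le {p : ℝ} (hp : 1 ≤ p) {F K : Polytorus → ℂ}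
    {W : Polytorus → ℝ} (hF : Continuous F) (hW : Continuous W)
    (hW0 : ∀ χ, 0 ≤ W χ) (hW1 : ∫ χ, W χ ∂polytorusHaar = 1) {C : ℝ} (hC : 0 ≤ C)
    (hKW : ∀ χ, ‖K χ‖ = C ^ (1 / p) * W χ ^ (1 - 1 / p)) :
    ‖∫ χ, K χ * F χ ∂polytorusHaar‖ₑ
      ≤ ENNReal.ofReal C ^ (1 / p) * eLpNorm F (ENNReal.ofReal p) polytorusHaar := by
  have hp0 : 0 < p := by linarith
  have hq0 : 0 ≤ 1 - 1 / p := by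
    rw [sub_nonneg, div_le_one hp0]
    exact hp
  have hWi : Integrable W polytorusHaar := by
    by_contra h
    rw [integral_undef h] at hW1
    exact zero_ne_one hW1
  have hW1' : ∫⁻ χ, ENNReal.ofReal (W χ) ∂polytorusHaar = 1 := by
    rw [← ofReal_integral_eq_lintegral_ofReal hWi (Eventually.of_forall hW0), hW1,
      ENNReal.ofReal_one]
  have hpt : ∀ χ, ‖K χ * F χ‖ₑ = ENNReal.ofReal C ^ (1 / p) *
      ((‖F χ‖ₑ ^ p) ^ (1 / p) * ENNReal.ofReal (W χ) ^ (1 - 1 / p)) := by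
    intro χ
    rw [enorm_mul, ← ofReal_norm (K χ), hKW, ENNReal.ofReal_mul (by positivity),
      ENNReal.ofReal_rpow_of_nonneg hC (by positivity),
      ENNReal.ofReal_rpow_of_nonneg (hW0 χ) hq0, ← ENNReal.rpow_mul, mul_one_div_cancel hp0.ne',
      ENNReal.rpow_one]
    ring
  have hFm : AEMeasurable (fun χ => ‖F χ‖ₑ ^ p) polytorusHaar :=
    (hF.measurable.enorm.pow_const p).aemeasurable
  calc ‖∫ χ, K χ * F χ ∂polytorusHaar‖ₑ ≤ ∫⁻ χ, ‖K χ * F χ‖ₑ ∂polytorusHaar :=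
        enorm_integral_le_lintegral_enorm _
    _ = ENNReal.ofReal C ^ (1 / p) * ∫⁻ χ, (‖F χ‖ₑ ^ p) ^ (1 / p) *
          ENNReal.ofReal (W χ) ^ (1 - 1 / p) ∂polytorusHaar := by
        simp only [hpt]
        rw [lintegral_const_mul' _ _
          (ENNReal.rpow_ne_top_of_nonneg (by positivity) ENNReal.ofReal_ne_top)]
    _ ≤ ENNReal.ofReal C ^ (1 / p) * ((∫⁻ χ, ‖F χ‖ₑ ^ p ∂polytorusHaar) ^ (1 / p) *
          (∫⁻ χ, ENNReal.ofReal (W χ) ∂polytorusHaar) ^ (1 - 1 / p)) := by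
        gcongr
        exact ENNReal.lintegral_mul_norm_pow_le hFm hW.measurable.ennreal_ofReal.aemeasurable
          (by positivity) hq0 (by ring)
    _ = _ := by
        rw [hW1', ENNReal.one_rpow, mul_one, eLpNorm_eq_lintegral_rpow_enorm_toReal
          (by simpa using hp0) ENNReal.ofReal_ne_top, ENNReal.toReal_ofReal hp0.le]

/-- One finite set of primes can serve all the terms of a polynomial, so that integrals against
product kernels factor over the same index set. -/
theorem bohrChar_eq_prod {n : ℕ+} {S : Finset Nat.Primes}
    (hS : ∀ q : Nat.Primes, (q : ℕ) ∣ n → q ∈ S) (χ : Polytorus) :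
    bohrChar χ n = ∏ q ∈ S, circleVal (χ q) ^ (n : ℕ).factorization q := by
  unfold bohrChar
  refine Finset.prod_of_injOn (fun q => (⟨q.1, Nat.prime_of_mem_primeFactors q.2⟩ : Nat.Primes))
    ?_ ?_ ?_ ?_
  · intro a _ b _ hab
    exact Subtype.ext (congrArg (fun q : Nat.Primes => (q : ℕ)) hab)
  · intro q _
    exact hS _ (Nat.dvd_of_mem_primeFactors q.2)
  · intro q _ hq
    have : (q : ℕ) ∉ (n : ℕ).primeFactors := fun h => hq ⟨⟨q, h⟩, by simp, rfl⟩
    rw [← Nat.support_factorization, Finsupp.notMem_support_iff] at this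
    rw [this, pow_zero]
  · intro q _
    rfl

theorem natCast_cpow_eq_prod {n : ℕ+} {S : Finset Nat.Primes}
    (hS : ∀ q : Nat.Primes, (q : ℕ) ∣ n → q ∈ S) (s : ℂ) :
    ((n : ℕ) : ℂ) ^ s = ∏ q ∈ S, (((q : ℕ) : ℂ) ^ s) ^ (n : ℕ).factorization q := by
  have h1 : (n : ℕ) = ∏ q ∈ S, (q : ℕ) ^ (n : ℕ).factorization q := by
    conv_lhs => rw [← Nat.prod_factorization_pow_eq_self n.ne_zero]
    rw [Finsupp.prod, ← Finset.prod_attach]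
    refine Finset.prod_of_injOn (fun q => (⟨q.1, Nat.prime_of_mem_primeFactors
      (by simpa only [Nat.support_factorization] using q.2)⟩ : Nat.Primes)) ?_ ?_ ?_ ?_
    · intro a _ b _ hab
      exact Subtype.ext (congrArg (fun q : Nat.Primes => (q : ℕ)) hab)
    · intro q _
      exact hS _ (Nat.dvd_of_mem_primeFactors
        (by simpa only [Nat.support_factorization] using q.2))
    · intro q _ hq
      have : (q : ℕ) ∉ (n : ℕ).factorization.support := fun h =>
        hq ⟨⟨q, h⟩, Finset.mem_coe.2 (Finset.mem_attach _ _), rfl⟩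
      rw [Finsupp.notMem_support_iff] at this
      rw [this, pow_zero]
    · intro q _
      rfl
  have h2 : ∀ (q k : ℕ), ((q ^ k : ℕ) : ℂ) ^ s = ((q : ℂ) ^ s) ^ k := by
    intro q k
    induction k with
    | zero => simp
    | succ k ih => rw [pow_succ, pow_succ, Nat.cast_mul, Complex.natCast_mul_natCast_cpow, ih]
  have h3 : ∀ (T : Finset Nat.Primes) (f : Nat.Primes → ℕ),
      ((∏ q ∈ T, f q : ℕ) : ℂ) ^ s = ∏ q ∈ T, ((f q : ℕ) : ℂ) ^ s := by
    intro T f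
    induction T using Finset.cons_induction with
    | empty => simp
    | cons a T ha ih =>
      rw [Finset.prod_cons, Finset.prod_cons, Nat.cast_mul, Complex.natCast_mul_natCast_cpow, ih]
  conv_lhs => rw [h1]
  rw [h3]
  exact Finset.prod_congr rfl fun q _ => h2 _ _

theorem continuous_bohrChar (n : ℕ+) : Continuous fun χ => bohrChar χ n := by
  unfold bohrChar
  refine continuous_finsetProd _ fun q _ => Continuous.pow ?_ _
  exact continuous_circleVal.comp (continuous_apply _)

theorem continuous_bohrLift (P : DirichletPoly) : Continuous (bohrLift P) := by
  unfold bohrLift Finsupp.sum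
  exact continuous_finsetSum _ fun n _ => continuous_const.mul (continuous_bohrChar n)

theorem integrable_polytorusHaar {F : Polytorus → ℂ} (hF : Continuous F) :
    Integrable F polytorusHaar := by
  have : CompactSpace Polytorus := Pi.compactSpace
  exact hF.integrable_of_hasCompactSupport (HasCompactSupport.of_compactSpace F)

theorem integral_mul_bohrLift {K : Polytorus → ℂ} (hK : Continuous K) (P : DirichletPoly) :
    ∫ χ, K χ * bohrLift P χ ∂polytorusHaar
      = P.sum fun n c => c * ∫ χ, K χ * bohrChar χ n ∂polytorusHaar := by
  unfold bohrLift Finsupp.sum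
  simp only [Finset.mul_sum]
  rw [integral_finsetSum P.support fun n _ => integrable_polytorusHaar
    (F := fun χ => K χ * (P n * bohrChar χ n))
    (hK.mul (continuous_const.mul (continuous_bohrChar n)))]
  refine Finset.sum_congr rfl fun n _ => ?_
  rw [← integral_const_mul]
  congr 1
  ext χ
  ring

theorem exists_finset_primes (P : DirichletPoly) :
    ∃ S : Finset Nat.Primes, ∀ n ∈ P.support, ∀ q : Nat.Primes, (q : ℕ) ∣ n → q ∈ S := by
  have h : ∀ n : ℕ+, {q : Nat.Primes | (q : ℕ) ∣ n}.Finite := fun n =>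
    Set.Finite.preimage (f := fun q : Nat.Primes => (q : ℕ)) (s := {d | d ∣ (n : ℕ)})
      (fun a _ b _ hab => Subtype.ext hab)
      ((Set.finite_Iic (n : ℕ)).subset fun d hd => Nat.le_of_dvd n.pos hd)
  refine ⟨P.support.biUnion fun n => (h n).toFinset, fun n hn q hq => ?_⟩
  rw [Finset.mem_biUnion]
  exact ⟨n, hn, by simpa using hq⟩

/-- The coefficient is a Fourier coefficient: integrate against the conjugate character, a kernel of
modulus one (`W = 1`, `C = 1`). -/
theorem enorm_coeff_le_hardyNorm {p : ℝ} (hp : 1 ≤ p) (P : DirichletPoly) (n : ℕ+) :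
    ‖P n‖ₑ ≤ hardyNorm p P := by
  obtain ⟨S, hSP, hSn⟩ : ∃ S : Finset Nat.Primes,
      (∀ m ∈ P.support, ∀ q : Nat.Primes, (q : ℕ) ∣ m → q ∈ S) ∧
        ∀ q : Nat.Primes, (q : ℕ) ∣ n → q ∈ S := by
    classical
    obtain ⟨S, hS⟩ := exists_finset_primes P
    obtain ⟨T, hT⟩ := exists_finset_primes (Finsupp.single n 1)
    refine ⟨S ∪ T, fun m hm q hq => Finset.mem_union_left _ (hS m hm q hq), fun q hq =>
      Finset.mem_union_right _ (hT n (by simp) q hq)⟩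
  have hK : Continuous fun χ => starRingEnd ℂ (bohrChar χ n) :=
    Complex.continuous_conj.comp (continuous_bohrChar n)
  have h1 : ∫ χ, starRingEnd ℂ (bohrChar χ n) * bohrLift P χ ∂polytorusHaar = P n := by
    rw [integral_mul_bohrLift hK, Finsupp.sum]
    have h2 : ∀ m ∈ P.support, ∫ χ, starRingEnd ℂ (bohrChar χ n) * bohrChar χ m ∂polytorusHaar
        = if m = n then 1 else 0 := by
      intro m hm
      simp only [bohrChar_eq_prod hSn, bohrChar_eq_prod (hSP m hm), map_prod, map_pow,
        ← Finset.prod_mul_distrib]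
      rw [integral_polytorusHaar_prod S (φ := fun q x => starRingEnd ℂ (circleVal x) ^
        (n : ℕ).factorization q * circleVal x ^ (m : ℕ).factorization q) fun q =>
        ((Complex.continuous_conj.comp continuous_circleVal).pow _).mul
          (continuous_circleVal.pow _)]
      simp only [mul_comm, integral_circleVal_pow_mul_conj_pow]
      split_ifs with hmn
      · simp [hmn]
      -- Distinct integers differ in the exponent of some prime of `S`, and the corresponding circle
      -- integral vanishes.
      · have : ∃ q ∈ S, (m : ℕ).factorization q ≠ (n : ℕ).factorization q := by
          by_contra! hcon
          refine hmn (PNat.coe_injective (Nat.eq_of_factorization_eq m.ne_zero n.ne_zero ?_))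
          intro q
          by_cases hq : q.Prime
          · by_cases hqS : (⟨q, hq⟩ : Nat.Primes) ∈ S
            · exact hcon _ hqS
            · rw [Nat.factorization_eq_zero_of_not_dvd fun h => hqS (hSP m hm ⟨q, hq⟩ h),
                Nat.factorization_eq_zero_of_not_dvd fun h => hqS (hSn ⟨q, hq⟩ h)]
          · simp [hq]
        obtain ⟨q, hq, hne⟩ := this
        exact Finset.prod_eq_zero hq (if_neg hne)
    rw [Finset.sum_congr rfl fun m hm => by rw [h2 m hm]]
    simp
    exact fun h => h.symm
  have h3 := enorm_integral_kernel_mul_le hp (continuous_bohrLift P) (continuous_const (y := 1))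
    (fun _ => zero_le_one) (by simp) zero_le_one (K := fun χ => starRingEnd ℂ (bohrChar χ n))
    (by
      intro χ
      simp only [Real.one_rpow, mul_one, RCLike.norm_conj, bohrChar_eq_prod hSn, norm_prod,
        norm_pow, norm_circleVal, one_pow, Finset.prod_const_one])
  rw [h1] at h3
  simpa [hardyNorm] using h3

/-- The value of a Dirichlet polynomial at a complex number. -/
noncomputable def dirichletEval (P : DirichletPoly) (s : ℂ) : ℂ :=
  P.sum fun n c => c * ((n : ℕ) : ℂ) ^ (-s)

/-- The product over `S` of the one-variable kernels reproduces the polynomial at `(w_q)`, and its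
bounds multiply. No factor depends on the size of `S` except through the product itself. -/
theorem enorm_sum_prod_pow_le {p : ℝ} (hp : 1 ≤ p) {S : Finset Nat.Primes} {P : DirichletPoly}
    (hS : ∀ n ∈ P.support, ∀ q : Nat.Primes, (q : ℕ) ∣ n → q ∈ S) {w : Nat.Primes → ℂ}
    (hw : ∀ q, ‖w q‖ < 1) :
    ‖P.sum fun n c => c * ∏ q ∈ S, w q ^ (n : ℕ).factorization q‖ₑ
      ≤ ENNReal.ofReal (∏ q ∈ S, (1 - ‖w q‖ ^ 2)⁻¹) ^ (1 / p) * hardyNorm p P := by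
  choose K W hK hW hW0 hW1 hKW hrep using fun q => exists_circle_kernel p (hw q)
  have hw2 : ∀ q, 0 ≤ (1 - ‖w q‖ ^ 2)⁻¹ := fun q =>
    inv_nonneg.2 (by nlinarith [norm_nonneg (w q), hw q])
  have h := enorm_integral_kernel_mul_le hp (continuous_bohrLift P)
    (W := fun χ => ∏ q ∈ S, W q (χ q)) (K := fun χ => ∏ q ∈ S, K q (χ q))
    (C := ∏ q ∈ S, (1 - ‖w q‖ ^ 2)⁻¹)
    (continuous_finsetProd _ fun q _ => (hW q).comp (continuous_apply q))
    (fun χ => Finset.prod_nonneg fun q _ => hW0 q _)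
    (by
      rw [integral_polytorusHaar_prod S hW]
      exact Finset.prod_eq_one fun q _ => hW1 q)
    (Finset.prod_nonneg fun q _ => hw2 q)
    (fun χ => by
      rw [norm_prod, ← Real.finsetProd_rpow _ _ (fun q _ => hw2 q),
        ← Real.finsetProd_rpow _ _ (fun q _ => hW0 q _), ← Finset.prod_mul_distrib]
      exact Finset.prod_congr rfl fun q _ => hKW q _)
  have h2 : ∫ χ, (∏ q ∈ S, K q (χ q)) * bohrLift P χ ∂polytorusHaar
      = P.sum fun n c => c * ∏ q ∈ S, w q ^ (n : ℕ).factorization q := by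
    rw [integral_mul_bohrLift (K := fun χ => ∏ q ∈ S, K q (χ q))
      (continuous_finsetProd _ fun q _ => (hK q).comp (continuous_apply q))]
    refine Finset.sum_congr rfl fun n hn => ?_
    simp only [bohrChar_eq_prod (hS n hn), ← Finset.prod_mul_distrib]
    rw [integral_polytorusHaar_prod S
      (φ := fun q x => K q x * circleVal x ^ (n : ℕ).factorization q)
      fun q => (hK q).mul (continuous_circleVal.pow _)]
    simp only [hrep]
  rw [h2] at h
  exact h

/-- The partial Euler products of `ζ` are at most the sum of the Dirichlet series. -/
theorem prod_one_sub_rpow_inv_le {x : ℝ} (hx : 1 < x) (S : Finset Nat.Primes) :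
    ∏ q ∈ S, (1 - ((q : ℕ) : ℝ) ^ (-x))⁻¹ ≤ ∑' n : ℕ, (n : ℝ) ^ (-x) := by
  classical
  let f : ℕ →* ℝ :=
    { toFun := fun n => (n : ℝ) ^ (-x)
      map_one' := by simp
      map_mul' := fun m n => by
        rw [Nat.cast_mul, Real.mul_rpow (Nat.cast_nonneg _) (Nat.cast_nonneg _)] }
  have h := (EulerProduct.summable_and_hasSum_factoredNumbers_prod_filter_prime_geometric (f := f)
    (fun {q} hq => by
      change ‖(q : ℝ) ^ (-x)‖ < 1
      rw [Real.norm_of_nonneg (by positivity)]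
      exact Real.rpow_lt_one_of_one_lt_of_neg (by exact_mod_cast hq.one_lt) (by linarith))
    (S.image fun q : Nat.Primes => (q : ℕ))).2
  have h2 : ∏ q ∈ S, (1 - ((q : ℕ) : ℝ) ^ (-x))⁻¹
      = ∏ q ∈ S.image (fun q : Nat.Primes => (q : ℕ)) with q.Prime, (1 - f q)⁻¹ := by
    rw [Finset.filter_true_of_mem, Finset.prod_image (g := fun q : Nat.Primes => (q : ℕ))
      (f := fun n => (1 - f n)⁻¹) fun a _ b _ hab => Subtype.ext hab]
    · rfl
    · intro q hq
      obtain ⟨r, -, rfl⟩ := Finset.mem_image.1 hq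
      exact r.2
  have hs : Summable fun n : ℕ => (n : ℝ) ^ (-x) := Real.summable_nat_rpow.2 (by linarith)
  rw [h2, ← h.tsum_eq]
  exact Summable.tsum_subtype_le _ _ (fun n => Real.rpow_nonneg (Nat.cast_nonneg n) _) hs

/-- Point evaluations on the Hardy space `H^p`. -/
theorem enorm_dirichletEval_le_hardyNorm {p : ℝ} (hp : 1 ≤ p) (P : DirichletPoly) {s : ℂ}
    (hs : 1 / 2 < s.re) :
    ‖dirichletEval P s‖ₑ
      ≤ ENNReal.ofReal (∑' n : ℕ, (n : ℝ) ^ (-(2 * s.re))) ^ (1 / p) * hardyNorm p P := by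
  obtain ⟨S, hS⟩ := exists_finset_primes P
  have hnorm : ∀ q : Nat.Primes, ‖((q : ℕ) : ℂ) ^ (-s)‖ = ((q : ℕ) : ℝ) ^ (-s.re) := fun q => by
    rw [Complex.norm_natCast_cpow_of_pos q.2.pos, Complex.neg_re]
  have hw : ∀ q : Nat.Primes, ‖((q : ℕ) : ℂ) ^ (-s)‖ < 1 := by
    intro q
    rw [hnorm]
    exact Real.rpow_lt_one_of_one_lt_of_neg (by exact_mod_cast q.2.one_lt) (by linarith)
  have h := enorm_sum_prod_pow_le hp hS hw
  have h1 : (P.sum fun n c => c * ∏ q ∈ S, (((q : ℕ) : ℂ) ^ (-s)) ^ (n : ℕ).factorization q)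
      = dirichletEval P s :=
    Finset.sum_congr rfl fun n hn => by
      simp only [natCast_cpow_eq_prod (hS n hn)]
  rw [h1] at h
  refine h.trans ?_
  gcongr
  refine le_trans (le_of_eq ?_) (prod_one_sub_rpow_inv_le (x := 2 * s.re) (by linarith) S)
  refine Finset.prod_congr rfl fun q _ => ?_
  rw [hnorm, ← Real.rpow_natCast, ← Real.rpow_mul (Nat.cast_nonneg _)]
  congr 4
  push_cast
  ring

/-! ### Bounds for Dirichlet polynomials in the Bergman norm. -/

theorem dirichletTranslate_apply (σ : ℝ) (P : DirichletPoly) (n : ℕ+) :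
    dirichletTranslate σ P n = P n * ((n : ℕ) : ℂ) ^ (-(σ : ℂ)) := by
  classical
  unfold dirichletTranslate Finsupp.sum
  rw [Finsupp.finsetSum_apply]
  simp only [Finsupp.single_apply]
  rw [Finset.sum_ite_eq']
  split_ifs with h
  · rfl
  · rw [Finsupp.notMem_support_iff.1 h, zero_mul]

theorem support_dirichletTranslate_subset (σ : ℝ) (P : DirichletPoly) :
    (dirichletTranslate σ P).support ⊆ P.support := by
  intro n hn
  rw [Finsupp.mem_support_iff, dirichletTranslate_apply] at hn
  exact Finsupp.mem_support_iff.2 (left_ne_zero_of_mul hn)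

theorem dirichletEval_dirichletTranslate (σ : ℝ) (P : DirichletPoly) (s : ℂ) :
    dirichletEval (dirichletTranslate σ P) s = dirichletEval P (s + σ) := by
  unfold dirichletEval
  rw [Finsupp.sum_of_support_subset _ (support_dirichletTranslate_subset σ P) _ (by simp)]
  refine Finset.sum_congr rfl fun n _ => ?_
  rw [dirichletTranslate_apply, mul_assoc, ← Complex.cpow_add _ _ (by simp)]
  congr 2
  ring

/-- Bounds by Hardy norms of translates integrate to bounds by the Bergman norm. -/
theorem enorm_le_bergmanPolyNorm {p : ℝ} (hp : 1 ≤ p) {μ : Measure ℝ} {ε : ℝ} {x : ℂ}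
    {A : ℝ≥0∞} (hA : A ≠ ∞) {P : DirichletPoly} (hμ : μ (Ioo 0 ε) ≠ 0) (hμ' : μ (Ioo 0 ε) ≠ ∞)
    (h : ∀ σ ∈ Ioo 0 ε, ‖x‖ₑ ≤ A ^ (1 / p) * hardyNorm p (dirichletTranslate σ P)) :
    ‖x‖ₑ ≤ (A / μ (Ioo 0 ε)) ^ (1 / p) * bergmanPolyNorm p μ P := by
  have hp0 : 0 < p := by linarith
  have h1 : ‖x‖ₑ ^ p * μ (Ioo 0 ε) ≤ A * ∫⁻ σ, hardyNorm p (dirichletTranslate σ P) ^ p ∂μ := by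
    rw [← lintegral_const_mul' _ _ hA, ← setLIntegral_const]
    refine le_trans (setLIntegral_mono' measurableSet_Ioo fun σ hσ => ?_)
      (setLIntegral_le_lintegral _ _)
    refine (ENNReal.rpow_le_rpow (h σ hσ) hp0.le).trans (le_of_eq ?_)
    rw [ENNReal.mul_rpow_of_nonneg _ _ hp0.le, ← ENNReal.rpow_mul, one_div_mul_cancel hp0.ne',
      ENNReal.rpow_one]
  unfold bergmanPolyNorm
  rw [← ENNReal.mul_rpow_of_nonneg _ _ (by positivity), one_div,
    ENNReal.le_rpow_inv_iff hp0, div_eq_mul_inv, mul_right_comm, ← div_eq_mul_inv,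
    ENNReal.le_div_iff_mul_le (Or.inl hμ) (Or.inl hμ')]
  exact h1

/-- The constant in the estimate of the point evaluations on `A^p_μ` for `Re s ≥ 1/2 + 2ε`. -/
noncomputable def bergmanEvalConst (p : ℝ) (μ : Measure ℝ) (ε : ℝ) : ℝ≥0∞ :=
  (ENNReal.ofReal (∑' n : ℕ, (n : ℝ) ^ (-(1 + 2 * ε))) / μ (Ioo 0 ε)) ^ (1 / p)

theorem bergmanEvalConst_ne_top {p : ℝ} (hp : 1 ≤ p) {μ : Measure ℝ} {ε : ℝ}
    (hμ : μ (Ioo 0 ε) ≠ 0) : bergmanEvalConst p μ ε ≠ ∞ :=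
  ENNReal.rpow_ne_top_of_nonneg (by positivity) (ENNReal.div_ne_top ENNReal.ofReal_ne_top hμ)

/-- Since `P(s) = P_σ(s - σ)` and `Re(s - σ) > 1/2 + ε` for `σ < ε`, the `H^p` estimate holds with
`ζ(1 + 2ε)` uniformly in these `σ`. -/
theorem enorm_dirichletEval_le {p : ℝ} (hp : 1 ≤ p) {μ : Measure ℝ} [IsFiniteMeasure μ] {ε : ℝ}
    (hε : 0 < ε) (hμ : μ (Ioo 0 ε) ≠ 0) (P : DirichletPoly) {s : ℂ} (hs : 1 / 2 + 2 * ε ≤ s.re) :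
    ‖dirichletEval P s‖ₑ ≤ bergmanEvalConst p μ ε * bergmanPolyNorm p μ P := by
  refine enorm_le_bergmanPolyNorm hp ENNReal.ofReal_ne_top hμ (measure_ne_top _ _) fun σ hσ => ?_
  have hs' : (s - σ).re = s.re - σ := by simp
  have h := enorm_dirichletEval_le_hardyNorm hp (dirichletTranslate σ P) (s := s - σ)
    (by rw [hs']; linarith [hσ.2])
  rw [dirichletEval_dirichletTranslate, sub_add_cancel] at h
  refine h.trans ?_
  have hle : ∑' n : ℕ, (n : ℝ) ^ (-(2 * (s - σ).re)) ≤ ∑' n : ℕ, (n : ℝ) ^ (-(1 + 2 * ε)) := by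
    have hx : 1 + 2 * ε ≤ 2 * (s - σ).re := by rw [hs']; linarith [hσ.2]
    refine Summable.tsum_le_tsum (fun n => ?_) (Real.summable_nat_rpow.2 (by linarith))
      (Real.summable_nat_rpow.2 (by linarith))
    rcases Nat.eq_zero_or_pos n with rfl | hn
    · rw [Nat.cast_zero, Real.zero_rpow (by linarith), Real.zero_rpow (by linarith)]
    · exact Real.rpow_le_rpow_of_exponent_le (by exact_mod_cast hn) (by linarith)
  gcongr

/-- A shift by `σ < 1` divides the `n`-th coefficient by at most `n`. Coefficients in `A^p_μ` thus
grow at most linearly, which ensures absolute convergence for `Re s > 2`. -/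
theorem enorm_coeff_le {p : ℝ} (hp : 1 ≤ p) {μ : Measure ℝ} [IsFiniteMeasure μ]
    (hμ : μ (Ioo 0 1) ≠ 0) (P : DirichletPoly) (n : ℕ+) :
    ‖P n / n‖ₑ ≤ (1 / μ (Ioo 0 1)) ^ (1 / p) * bergmanPolyNorm p μ P := by
  refine enorm_le_bergmanPolyNorm hp ENNReal.one_ne_top hμ (measure_ne_top _ _) fun σ hσ => ?_
  rw [ENNReal.one_rpow, one_mul]
  refine le_trans ?_ (enorm_coeff_le_hardyNorm hp _ n)
  have hn : (1 : ℝ) ≤ (n : ℕ) := by exact_mod_cast n.pos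
  rw [dirichletTranslate_apply, enorm_le_iff_norm_le, norm_div, norm_mul,
    Complex.norm_natCast_cpow_of_pos n.pos, div_eq_mul_inv]
  gcongr
  rw [Complex.norm_natCast, ← Real.rpow_neg_one]
  refine Real.rpow_le_rpow_of_exponent_le hn ?_
  simpa using hσ.2.le

/-! ### Uniqueness of the holomorphic extension. -/

theorem isOpen_re_gt (c : ℝ) : IsOpen {s : ℂ | c < s.re} :=
  isOpen_lt continuous_const Complex.continuous_re

theorem eq_of_differentiableOn_re_gt {c R : ℝ} {f g : ℂ → ℂ}
    (hf : DifferentiableOn ℂ f {s | c < s.re}) (hg : DifferentiableOn ℂ g {s | c < s.re})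
    (h : ∀ s : ℂ, c < s.re → R < s.re → f s = g s) {s : ℂ} (hs : c < s.re) : f s = g s := by
  have hz : max c R < ((max c R + 1 : ℝ) : ℂ).re := by simp
  refine (hf.analyticOnNhd (isOpen_re_gt c)).eqOn_of_preconnected_of_eventuallyEq
    (hg.analyticOnNhd (isOpen_re_gt c)) (convex_halfSpace_re_gt c).isPreconnected
    (z₀ := ((max c R + 1 : ℝ) : ℂ)) ((le_max_left c R).trans_lt hz) ?_ hs
  filter_upwards [(isOpen_re_gt (max c R)).mem_nhds hz] with z hz'
  exact h z ((le_max_left c R).trans_lt hz') ((le_max_right c R).trans_lt hz')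

theorem exists_real_gt_abscissa {a : ℕ → ℂ} (ha : LSeries.abscissaOfAbsConv a < ⊤) :
    ∃ R : ℝ, LSeries.abscissaOfAbsConv a < R := by
  obtain ⟨R, hR, -⟩ := EReal.lt_iff_exists_real_btwn.1 ha
  exact ⟨R, hR⟩

/-- It suffices to check `IsFunctionOf` far to the right. -/
theorem isFunctionOf_of_eventually {a : ℕ → ℂ} {f : ℂ → ℂ} {R : ℝ}
    (ha : LSeries.abscissaOfAbsConv a < ⊤) (hf : DifferentiableOn ℂ f {s : ℂ | 1 / 2 < s.re})
    (h : ∀ s : ℂ, 1 / 2 < s.re → R < s.re → f s = LSeries a s) : IsFunctionOf a f := by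
  refine ⟨ha, hf, fun s hs has => ?_⟩
  have hmax : max (((1 / 2 : ℝ)) : EReal) (LSeries.abscissaOfAbsConv a) < s.re :=
    max_lt (by exact_mod_cast hs) has
  -- On `Re z > c` both `f` and the series are holomorphic, so the identity theorem carries their
  -- agreement back to `s`.
  obtain ⟨c, hc, hcs⟩ := EReal.lt_iff_exists_real_btwn.1 hmax
  have hc1 : 1 / 2 < c := by exact_mod_cast (le_max_left _ _).trans_lt hc
  have hc2 := (le_max_right _ _).trans_lt hc
  refine eq_of_differentiableOn_re_gt (c := c) (R := R)
    (hf.mono fun z (hz : c < z.re) => hc1.trans hz)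
    ((LSeries_differentiableOn a).mono fun z (hz : c < z.re) =>
      hc2.trans (by exact_mod_cast hz)) (fun z hz hR => h z (hc1.trans hz) hR)
    (by exact_mod_cast hcs)

theorem IsFunctionOf.eq {a : ℕ → ℂ} {f g : ℂ → ℂ} (hf : IsFunctionOf a f)
    (hg : IsFunctionOf a g) {s : ℂ} (hs : 1 / 2 < s.re) : f s = g s := by
  obtain ⟨R, hR⟩ := exists_real_gt_abscissa hf.1
  refine eq_of_differentiableOn_re_gt (R := R) hf.2.1 hg.2.1 (fun z hz hzR => ?_) hs
  have : LSeries.abscissaOfAbsConv a < z.re := hR.trans (by exact_mod_cast hzR)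
  rw [hf.2.2 z hz this, hg.2.2 z hz this]

theorem dirichletEval_sub (P Q : DirichletPoly) (s : ℂ) :
    dirichletEval (P - Q) s = dirichletEval P s - dirichletEval Q s :=
  Finsupp.sum_sub_index fun _ _ _ => sub_mul _ _ _

theorem differentiable_dirichletEval (P : DirichletPoly) : Differentiable ℂ (dirichletEval P) := by
  unfold dirichletEval Finsupp.sum
  intro s
  refine DifferentiableAt.fun_sum fun n _ => DifferentiableAt.const_mul ?_ _
  exact DifferentiableAt.const_cpow (by fun_prop) (Or.inl (by simp))

/-! ### Elements of the completion as holomorphic functions. -/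

section

variable {p : ℝ} {μ : Measure ℝ}

theorem IsBergmanLimit.uniformCauchySeqOn [IsFiniteMeasure μ] {P : ℕ → DirichletPoly} {b : ℕ → ℂ}
    (h : IsBergmanLimit p μ P b) (hp : 1 ≤ p) {ε : ℝ} (hε : 0 < ε) (hμ : μ (Ioo 0 ε) ≠ 0) :
    UniformCauchySeqOn (fun k => dirichletEval (P k)) atTop {s | 1 / 2 + 2 * ε ≤ s.re} := by
  rw [Metric.uniformCauchySeqOn_iff]
  intro e he
  obtain ⟨δ, hδ, hδe⟩ := ENNReal.exists_nnreal_pos_mul_lt (bergmanEvalConst_ne_top hp hμ)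
    (b := ENNReal.ofReal e) (by simpa using he)
  obtain ⟨K, hK⟩ := h.1 δ (by exact_mod_cast hδ)
  refine ⟨K, fun m hm n hn s hs => ?_⟩
  have h1 : ‖dirichletEval (P m - P n) s‖ₑ < ENNReal.ofReal e := by
    refine (enorm_dirichletEval_le hp hε hμ _ hs).trans_lt (lt_of_le_of_lt ?_ hδe)
    rw [mul_comm]
    gcongr
    exact hK m hm n hn
  rw [dirichletEval_sub, ← ofReal_norm, ENNReal.ofReal_lt_ofReal_iff he] at h1
  rwa [dist_eq_norm]

/-- The bound is uniform in `k` and `n`, as dominated convergence of the series requires. -/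
theorem IsBergmanLimit.exists_coeff_bound [IsFiniteMeasure μ] {P : ℕ → DirichletPoly} {b : ℕ → ℂ}
    (h : IsBergmanLimit p μ P b) (hp : 1 ≤ p) (hμ : μ (Ioo 0 1) ≠ 0) :
    ∃ C : ℝ, ∀ᶠ k in atTop, ∀ n : ℕ+, ‖P k n‖ ≤ C * n := by
  obtain ⟨K, hK⟩ := h.1 1 one_pos
  set A : ℝ≥0∞ := (1 / μ (Ioo 0 1)) ^ (1 / p) with hA
  have hAtop : A ≠ ∞ := ENNReal.rpow_ne_top_of_nonneg (by positivity)
    (ENNReal.div_ne_top ENNReal.one_ne_top hμ)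
  refine ⟨A.toReal + ∑ n ∈ (P K).support, ‖P K n‖, ?_⟩
  filter_upwards [eventually_ge_atTop K] with k hk n
  have hn : (1 : ℝ) ≤ n := by exact_mod_cast n.pos
  have h1 : ‖(P k - P K) n / n‖ₑ ≤ ENNReal.ofReal A.toReal := by
    rw [ENNReal.ofReal_toReal hAtop]
    refine (enorm_coeff_le hp hμ _ n).trans ?_
    calc A * bergmanPolyNorm p μ (P k - P K) ≤ A * 1 := by
          gcongr
          exact hK k hk K le_rfl
      _ = A := mul_one _
  rw [← ofReal_norm, ENNReal.ofReal_le_ofReal_iff ENNReal.toReal_nonneg, norm_div,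
    Complex.norm_natCast, div_le_iff₀ (by linarith), Finsupp.sub_apply] at h1
  have h2 : ‖P K n‖ ≤ ∑ n ∈ (P K).support, ‖P K n‖ := by
    by_cases hnK : n ∈ (P K).support
    · exact Finset.single_le_sum (f := fun n => ‖P K n‖) (fun _ _ => norm_nonneg _) hnK
    · rw [Finsupp.notMem_support_iff.1 hnK, norm_zero]
      exact Finset.sum_nonneg fun _ _ => norm_nonneg _
  have h3 : 0 ≤ ∑ n ∈ (P K).support, ‖P K n‖ := Finset.sum_nonneg fun _ _ => norm_nonneg _
  have h4 := norm_sub_norm_le (P k n) (P K n)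
  nlinarith

theorem tsum_term_pnat (b : ℕ → ℂ) (s : ℂ) :
    ∑' n : ℕ+, b n * ((n : ℕ) : ℂ) ^ (-s) = LSeries b s := by
  rw [LSeries, ← PNat.coe_injective.tsum_eq (f := LSeries.term b s)]
  · refine tsum_congr fun n => ?_
    rw [LSeries.term_of_ne_zero n.ne_zero, Complex.cpow_neg, div_eq_mul_inv]
  · intro n hn
    refine ⟨⟨n, Nat.pos_of_ne_zero fun h => hn ?_⟩, rfl⟩
    rw [h, LSeries.term_zero]

/-- The evaluation bounds give a locally uniform, hence holomorphic, limit on `Re s > 1/2`. For `Re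
s > 2` the linear coefficient bound allows the limit to be taken term by term, which identifies it
with the series of `b`. -/
theorem IsBergmanLimit.exists_isFunctionOf [IsFiniteMeasure μ] {P : ℕ → DirichletPoly} {b : ℕ → ℂ}
    (h : IsBergmanLimit p μ P b) (hp : 1 ≤ p) (hμ : ∀ ε : ℝ, 0 < ε → μ (Ioo 0 ε) ≠ 0) :
    ∃ g, IsFunctionOf b g ∧
      ∀ s : ℂ, 1 / 2 < s.re → Tendsto (fun k => dirichletEval (P k) s) atTop (𝓝 (g s)) := by
  have hmem : ∀ s : ℂ, 1 / 2 < s.re → ∃ ε > 0, 1 / 2 + 2 * ε < s.re := fun s hs =>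
    ⟨(s.re - 1 / 2) / 4, by linarith, by linarith⟩
  have hlim : ∀ s : ℂ, ∃ y, 1 / 2 < s.re →
      Tendsto (fun k => dirichletEval (P k) s) atTop (𝓝 y) := by
    intro s
    by_cases hs : 1 / 2 < s.re
    · obtain ⟨ε, hε, hεs⟩ := hmem s hs
      have := (h.uniformCauchySeqOn hp hε (hμ ε hε)).cauchySeq
        (x := s) hεs.le
      obtain ⟨y, hy⟩ := cauchySeq_tendsto_of_complete this
      exact ⟨y, fun _ => hy⟩
    · exact ⟨0, fun h => absurd h hs⟩
  choose g hg using hlim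
  have hdiff : DifferentiableOn ℂ g {s : ℂ | 1 / 2 < s.re} := by
    refine TendstoLocallyUniformlyOn.differentiableOn (φ := atTop)
      (F := fun k => dirichletEval (P k)) ?_
      (Eventually.of_forall fun k => (differentiable_dirichletEval _).differentiableOn)
      (isOpen_re_gt _)
    refine tendstoLocallyUniformlyOn_of_forall_exists_nhds fun s hs => ?_
    obtain ⟨ε, hε, hεs⟩ := hmem s hs
    refine ⟨{z | 1 / 2 + 2 * ε ≤ z.re}, mem_nhdsWithin_of_mem_nhds
      (mem_of_superset ((isOpen_re_gt _).mem_nhds hεs) fun z (hz : _ < z.re) => hz.le), ?_⟩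
    exact (h.uniformCauchySeqOn hp hε (hμ ε hε)).tendstoUniformlyOn_of_tendsto
      fun z hz => hg z (by simp only [mem_ofPred_eq] at hz; linarith)
  obtain ⟨C, hC⟩ := h.exists_coeff_bound hp (hμ 1 one_pos)
  have hb : ∀ n : ℕ, n ≠ 0 → ‖b n‖ ≤ C * n := by
    intro n hn
    refine le_of_tendsto (h.2 ⟨n, Nat.pos_of_ne_zero hn⟩).norm ?_
    filter_upwards [hC] with k hk
    exact hk ⟨n, Nat.pos_of_ne_zero hn⟩
  have habs : LSeries.abscissaOfAbsConv b < ⊤ :=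
    (LSeries.abscissaOfAbsConv_le_of_le_const_mul_rpow (x := 1)
      ⟨C, fun n hn => by simpa using hb n hn⟩).trans_lt (by exact_mod_cast EReal.coe_lt_top (1 + 1))
  refine ⟨g, isFunctionOf_of_eventually (R := 2) habs hdiff fun s hs hs2 => ?_, hg⟩
  refine tendsto_nhds_unique (hg s hs) ?_
  rw [← tsum_term_pnat]
  have heval : ∀ k, dirichletEval (P k) s = ∑' n : ℕ+, P k n * ((n : ℕ) : ℂ) ^ (-s) := by
    intro k
    rw [tsum_eq_sum (s := (P k).support) fun n hn => by
      rw [Finsupp.notMem_support_iff.1 hn, zero_mul]]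
    rfl
  simp only [heval]
  refine tendsto_tsum_of_dominated_convergence
    (bound := fun n : ℕ+ => C * ((n : ℕ) : ℝ) ^ (1 - s.re)) ?_ (fun n => (h.2 n).mul_const _) ?_
  · exact ((Real.summable_nat_rpow.2 (by linarith)).comp_injective PNat.coe_injective).mul_left C
  · filter_upwards [hC] with k hk n
    have hn : (0 : ℝ) < (n : ℕ) := by exact_mod_cast n.pos
    rw [norm_mul, Complex.norm_natCast_cpow_of_pos n.pos, Complex.neg_re, sub_eq_add_neg,
      Real.rpow_add hn, Real.rpow_one, ← mul_assoc]
    gcongr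
    exact hk n

/-- A bound for a functional on the Dirichlet polynomials extends to the completion. -/
theorem enorm_le_mul_bergmanNorm {b : ℕ → ℂ} (hb : bergmanNorm p μ b < ∞)
    {x : DirichletPoly → ℂ} {y : ℂ} {M : ℝ≥0∞} (hM : M ≠ ∞)
    (hx : ∀ P, ‖x P‖ₑ ≤ M * bergmanPolyNorm p μ P)
    (hy : ∀ P, IsBergmanLimit p μ P b → Tendsto (fun k => x (P k)) atTop (𝓝 y)) :
    ‖y‖ₑ ≤ M * bergmanNorm p μ b := by
  -- The general argument divides by `M`; for `M = 0` the functional vanishes identically.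
  rcases eq_or_ne M 0 with rfl | hM0
  · obtain ⟨P, hP⟩ := iInf_lt_iff.1 hb
    obtain ⟨hP, -⟩ := iInf_lt_iff.1 hP
    have h0 : ∀ k, x (P k) = 0 := fun k => by simpa using hx (P k)
    have := hy P hP
    simp only [h0] at this
    simp [← tendsto_nhds_unique tendsto_const_nhds this]
  · rw [mul_comm, ← ENNReal.div_le_iff hM0 hM]
    refine le_iInf₂ fun P hP => ?_
    have h1 : Tendsto (fun k => ‖x (P k)‖ₑ / M) atTop (𝓝 (‖y‖ₑ / M)) :=
      ((ENNReal.continuous_div_const M hM0).tendsto _).comp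
        ((continuous_enorm.tendsto _).comp (hy P hP))
    rw [← h1.liminf_eq]
    exact liminf_le_liminf (Eventually.of_forall fun k => ENNReal.div_le_of_le_mul' (hx (P k)))

theorem exists_isFunctionOf_of_bergmanNorm_lt_top [IsFiniteMeasure μ] {b : ℕ → ℂ} (hp : 1 ≤ p)
    (hμ : ∀ ε : ℝ, 0 < ε → μ (Ioo 0 ε) ≠ 0) (hb : bergmanNorm p μ b < ∞) :
    ∃ g, IsFunctionOf b g := by
  obtain ⟨P, hP⟩ := iInf_lt_iff.1 hb
  obtain ⟨hP, -⟩ := iInf_lt_iff.1 hP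
  obtain ⟨g, hg, -⟩ := hP.exists_isFunctionOf hp hμ
  exact ⟨g, hg⟩

theorem IsFunctionOf.enorm_le [IsFiniteMeasure μ] {b : ℕ → ℂ} {g : ℂ → ℂ}
    (hg : IsFunctionOf b g) (hp : 1 ≤ p) (hμ : ∀ ε : ℝ, 0 < ε → μ (Ioo 0 ε) ≠ 0)
    (hb : bergmanNorm p μ b < ∞) {ε : ℝ} (hε : 0 < ε) {s : ℂ} (hs : 1 / 2 + 2 * ε ≤ s.re) :
    ‖g s‖ₑ ≤ bergmanEvalConst p μ ε * bergmanNorm p μ b := by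
  refine enorm_le_mul_bergmanNorm hb (bergmanEvalConst_ne_top hp (hμ ε hε))
    (fun P => enorm_dirichletEval_le hp hε (hμ ε hε) P hs) fun P hP => ?_
  obtain ⟨g', hg', hlim⟩ := hP.exists_isFunctionOf hp hμ
  rw [hg.eq hg' (by linarith)]
  exact hlim s (by linarith)

theorem enorm_coeff_le_bergmanNorm [IsFiniteMeasure μ] {b : ℕ → ℂ} (hp : 1 ≤ p)
    (hμ : μ (Ioo 0 1) ≠ 0) (hb : bergmanNorm p μ b < ∞) (n : ℕ+) :
    ‖b n / n‖ₑ ≤ (1 / μ (Ioo 0 1)) ^ (1 / p) * bergmanNorm p μ b :=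
  enorm_le_mul_bergmanNorm hb (ENNReal.rpow_ne_top_of_nonneg (by positivity)
    (ENNReal.div_ne_top ENNReal.one_ne_top hμ)) (fun P => enorm_coeff_le hp hμ P n)
    fun P hP => (hP.2 n).div_const _

theorem bergmanInftyEvalNorm_le [IsFiniteMeasure μ] (hp : 1 ≤ p)
    (hμ : ∀ ε : ℝ, 0 < ε → μ (Ioo 0 ε) ≠ 0) {ε : ℝ} (hε : 0 < ε) {s : ℂ}
    (hs : 1 / 2 + 2 * ε ≤ s.re) :
    bergmanInftyEvalNorm p μ s ≤ bergmanEvalConst p μ ε := by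
  refine iSup₂_le fun b g => iSup₂_le fun hbV hb1 => iSup_le fun hg => ?_
  calc ‖g s‖ₑ ≤ bergmanEvalConst p μ ε * bergmanNorm p μ b := hg.enorm_le hp hμ hbV.2 hε hs
    _ ≤ bergmanEvalConst p μ ε * 1 := by gcongr
    _ = _ := mul_one _

end

/-! ### Invariance under vertical translations. -/

/-- The Dirichlet polynomial `∑ c aₙ n^{-iy} n^{-s}`. -/
noncomputable def verticalTwist (c : ℂ) (y : ℝ) (P : DirichletPoly) : DirichletPoly :=
  P.sum fun n a => Finsupp.single n (a * (c * ((n : ℕ) : ℂ) ^ (-(y * Complex.I))))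

theorem verticalTwist_apply (c : ℂ) (y : ℝ) (P : DirichletPoly) (n : ℕ+) :
    verticalTwist c y P n = P n * (c * ((n : ℕ) : ℂ) ^ (-(y * Complex.I))) := by
  classical
  unfold verticalTwist Finsupp.sum
  rw [Finsupp.finsetSum_apply]
  simp only [Finsupp.single_apply]
  rw [Finset.sum_ite_eq']
  split_ifs with h
  · rfl
  · rw [Finsupp.notMem_support_iff.1 h, zero_mul]

theorem verticalTwist_sub (c : ℂ) (y : ℝ) (P Q : DirichletPoly) :
    verticalTwist c y (P - Q) = verticalTwist c y P - verticalTwist c y Q := by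
  ext n
  simp only [verticalTwist_apply, Finsupp.sub_apply]
  ring

theorem dirichletTranslate_verticalTwist (c : ℂ) (y σ : ℝ) (P : DirichletPoly) :
    dirichletTranslate σ (verticalTwist c y P) = verticalTwist c y (dirichletTranslate σ P) := by
  ext n
  simp only [verticalTwist_apply, dirichletTranslate_apply]
  ring

/-- The point of the polytorus which corresponds to `n ↦ n^{-iy}`. -/
noncomputable def verticalFlow (y : ℝ) : Polytorus :=
  fun q => ((-(y * Real.log (q : ℕ)) / (2 * Real.pi) : ℝ) : UnitAddCircle)

theorem circleVal_add (x y : UnitAddCircle) :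
    circleVal (x + y) = circleVal x * circleVal y := by
  simp [circleVal, AddCircle.toCircle_add]

theorem circleVal_verticalFlow (y : ℝ) (q : Nat.Primes) :
    circleVal (verticalFlow y q) = ((q : ℕ) : ℂ) ^ (-(y * Complex.I)) := by
  have hq : ((q : ℕ) : ℂ) ≠ 0 := by exact_mod_cast q.2.ne_zero
  rw [Complex.cpow_def_of_ne_zero hq, circleVal, verticalFlow, AddCircle.toCircle_apply_mk,
    Circle.coe_exp, ← Complex.natCast_log]
  congr 1
  push_cast
  have : (Real.pi : ℂ) ≠ 0 := by exact_mod_cast Real.pi_ne_zero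
  field_simp

theorem bohrChar_add_verticalFlow (y : ℝ) (χ : Polytorus) (n : ℕ+) :
    bohrChar (χ + verticalFlow y) n = bohrChar χ n * ((n : ℕ) : ℂ) ^ (-(y * Complex.I)) := by
  obtain ⟨S, hS⟩ := exists_finset_primes (Finsupp.single n 1)
  have hS' := hS n (by simp)
  rw [bohrChar_eq_prod hS', bohrChar_eq_prod hS', natCast_cpow_eq_prod hS',
    ← Finset.prod_mul_distrib]
  refine Finset.prod_congr rfl fun q _ => ?_
  rw [← circleVal_verticalFlow, ← mul_pow, ← circleVal_add]
  rfl

theorem bohrLift_verticalTwist (c : ℂ) (y : ℝ) (P : DirichletPoly) (χ : Polytorus) :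
    bohrLift (verticalTwist c y P) χ = c * bohrLift P (χ + verticalFlow y) := by
  have hsub : (verticalTwist c y P).support ⊆ P.support := by
    intro n hn
    rw [Finsupp.mem_support_iff, verticalTwist_apply] at hn
    exact Finsupp.mem_support_iff.2 (left_ne_zero_of_mul hn)
  unfold bohrLift
  rw [Finsupp.sum_of_support_subset _ hsub _ (by simp), Finsupp.sum, Finset.mul_sum]
  refine Finset.sum_congr rfl fun n _ => ?_
  rw [verticalTwist_apply, bohrChar_add_verticalFlow]
  ring

theorem measurePreserving_add_polytorus (ω : Polytorus) :
    MeasurePreserving (fun χ : Polytorus => χ + ω) polytorusHaar polytorusHaar := by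
  refine ⟨by fun_prop, ?_⟩
  have h := Measure.infinitePi_map_pi
    (μ := fun _ : Nat.Primes => (AddCircle.haarAddCircle : Measure UnitAddCircle))
    (f := fun q x => x + ω q) fun q => measurable_add_const (ω q)
  have h2 : ∀ q, Measure.map (fun x : UnitAddCircle => x + ω q) AddCircle.haarAddCircle
      = AddCircle.haarAddCircle := fun q => map_add_right_eq_self _ _
  simp only [h2] at h
  exact h

/-- The character `n ↦ n^{-iy}` is a point of the polytorus, so the twist is a rotation followed by
multiplication by `c`, and Haar measure is invariant. -/
theorem hardyNorm_verticalTwist (p : ℝ) (c : ℂ) (y : ℝ) (P : DirichletPoly) :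
    hardyNorm p (verticalTwist c y P) = ‖c‖ₑ * hardyNorm p P := by
  unfold hardyNorm
  have h : bohrLift (verticalTwist c y P)
      = c • (bohrLift P ∘ fun χ : Polytorus => χ + verticalFlow y) := by
    ext χ
    simp [bohrLift_verticalTwist]
  rw [h, eLpNorm_const_smul, eLpNorm_comp_measurePreserving
    (continuous_bohrLift P).measurable.aestronglyMeasurable (measurePreserving_add_polytorus _)]

section

variable {p : ℝ} {μ : Measure ℝ}

theorem bergmanPolyNorm_verticalTwist (hp : 1 ≤ p) (c : ℂ) (y : ℝ) (P : DirichletPoly) :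
    bergmanPolyNorm p μ (verticalTwist c y P) = ‖c‖ₑ * bergmanPolyNorm p μ P := by
  have hp0 : 0 < p := by linarith
  unfold bergmanPolyNorm
  simp only [dirichletTranslate_verticalTwist, hardyNorm_verticalTwist,
    ENNReal.mul_rpow_of_nonneg _ _ hp0.le]
  rw [lintegral_const_mul' _ _ (ENNReal.rpow_ne_top_of_nonneg hp0.le enorm_ne_top),
    ENNReal.mul_rpow_of_nonneg _ _ (by positivity), ← ENNReal.rpow_mul,
    mul_one_div_cancel hp0.ne', ENNReal.rpow_one]

/-- The coefficients of `c f(s + iy)`. -/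
noncomputable def twistCoeff (c : ℂ) (y : ℝ) (b : ℕ → ℂ) : ℕ → ℂ :=
  fun n => b n * (c * (n : ℂ) ^ (-(y * Complex.I)))

theorem IsBergmanLimit.twist {P : ℕ → DirichletPoly} {b : ℕ → ℂ}
    (h : IsBergmanLimit p μ P b) (hp : 1 ≤ p) {c : ℂ} (hc : c ≠ 0) (y : ℝ) :
    IsBergmanLimit p μ (fun k => verticalTwist c y (P k)) (twistCoeff c y b) := by
  constructor
  · intro ε hε
    obtain ⟨K, hK⟩ := h.1 (ε / ‖c‖ₑ) (ENNReal.div_pos hε.ne' enorm_ne_top)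
    refine ⟨K, fun j hj k hk => ?_⟩
    rw [← verticalTwist_sub, bergmanPolyNorm_verticalTwist hp, mul_comm]
    exact (ENNReal.le_div_iff_mul_le (Or.inl (by simpa using hc)) (Or.inl enorm_ne_top)).1
      (hK j hj k hk)
  · intro n
    simp only [verticalTwist_apply]
    exact (h.2 n).mul_const _

theorem bergmanNorm_twistCoeff_le (hp : 1 ≤ p) {c : ℂ} (hc : c ≠ 0) (y : ℝ) (b : ℕ → ℂ) :
    bergmanNorm p μ (twistCoeff c y b) ≤ ‖c‖ₑ * bergmanNorm p μ b := by
  have hc0 : ‖c‖ₑ ≠ 0 := by simpa using hc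
  rw [mul_comm, ← ENNReal.div_le_iff hc0 enorm_ne_top]
  refine le_iInf₂ fun P hP => ?_
  rw [ENNReal.div_le_iff hc0 enorm_ne_top, mul_comm,
    ← ENNReal.liminf_const_mul_of_ne_top enorm_ne_top]
  have h : bergmanNorm p μ (twistCoeff c y b)
      ≤ liminf (fun k => bergmanPolyNorm p μ (verticalTwist c y (P k))) atTop :=
    iInf₂_le (fun k => verticalTwist c y (P k)) (hP.twist hp hc y)
  refine h.trans (le_of_eq ?_)
  simp only [bergmanPolyNorm_verticalTwist hp]

theorem term_twistCoeff (c : ℂ) (y : ℝ) (b : ℕ → ℂ) (s : ℂ) (n : ℕ) :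
    LSeries.term (twistCoeff c y b) s n = c * LSeries.term b (s + y * Complex.I) n := by
  rcases eq_or_ne n 0 with rfl | hn
  · simp
  · have hn' : (n : ℂ) ≠ 0 := by exact_mod_cast hn
    rw [LSeries.term_of_ne_zero hn, LSeries.term_of_ne_zero hn, Complex.cpow_add _ _ hn',
      twistCoeff, Complex.cpow_neg]
    field_simp

theorem abscissaOfAbsConv_twistCoeff {c : ℂ} (hc : c ≠ 0) (y : ℝ) (b : ℕ → ℂ) :
    LSeries.abscissaOfAbsConv (twistCoeff c y b) = LSeries.abscissaOfAbsConv b := by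
  have h : ∀ x : ℝ, LSeriesSummable (twistCoeff c y b) x ↔ LSeriesSummable b x := by
    intro x
    unfold LSeriesSummable
    have : LSeries.term (twistCoeff c y b) x = fun n => c * LSeries.term b (x + y * Complex.I) n :=
      funext (term_twistCoeff c y b x)
    rw [this, summable_mul_left_iff hc]
    exact LSeriesSummable_iff_of_re_eq_re (by simp)
  unfold LSeries.abscissaOfAbsConv
  simp only [h]

theorem IsFunctionOf.twist {b : ℕ → ℂ} {g : ℂ → ℂ} (hg : IsFunctionOf b g) {c : ℂ}
    (hc : c ≠ 0) (y : ℝ) :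
    IsFunctionOf (twistCoeff c y b) (fun s => c * g (s + y * Complex.I)) := by
  refine ⟨by rw [abscissaOfAbsConv_twistCoeff hc]; exact hg.1, ?_, fun s hs has => ?_⟩
  · refine DifferentiableOn.const_mul (hg.2.1.comp (by fun_prop) fun s hs => ?_) c
    simpa using hs
  · rw [abscissaOfAbsConv_twistCoeff hc] at has
    simp only
    rw [hg.2.2 _ (by simpa using hs) (by simpa using has)]
    simp only [LSeries, term_twistCoeff, tsum_mul_left]

/-- Point evaluations are controlled by the evaluation norm on the real line. -/
theorem IsFunctionOf.enorm_le_evalNorm [IsFiniteMeasure μ] {b : ℕ → ℂ} {g : ℂ → ℂ}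
    (hg : IsFunctionOf b g) (hp : 1 ≤ p) (hμ : ∀ ε : ℝ, 0 < ε → μ (Ioo 0 ε) ≠ 0)
    (hb : b ∈ bergmanSpaceInfty p μ) {t : ℝ} (ht : 1 / 2 < t) (y : ℝ) :
    ‖g (t + y * Complex.I)‖ₑ ≤ bergmanInftyEvalNorm p μ t * bergmanNorm p μ b := by
  -- A series of norm `0` cannot be normalized, but the evaluation bound shows that its values
  -- vanish.
  rcases eq_or_ne (bergmanNorm p μ b) 0 with h0 | h0
  · have := hg.enorm_le hp hμ hb.2 (ε := (t - 1 / 2) / 4) (by linarith) (s := t + y * Complex.I)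
      (by simp; linarith)
    rw [h0, mul_zero] at this ⊢
    exact this
  · set N := bergmanNorm p μ b
    have hN : N ≠ ∞ := hb.2.ne
    -- With `c = 1/N` the function `c g(· + iy)` is in the unit ball, and its value at the real
    -- point `t` is `c g(t + iy)`.
    set c : ℂ := ((N⁻¹).toReal : ℂ) with hcdef
    have hNinv : N⁻¹ ≠ ∞ := ENNReal.inv_ne_top.2 h0
    have hce : ‖c‖ₑ = N⁻¹ := by
      rw [← ofReal_norm, hcdef, Complex.norm_real, Real.norm_of_nonneg ENNReal.toReal_nonneg,
        ENNReal.ofReal_toReal hNinv]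
    have hc : c ≠ 0 := by
      rw [← enorm_ne_zero, hce]
      exact ENNReal.inv_ne_zero.2 hN
    have hle : bergmanNorm p μ (twistCoeff c y b) ≤ 1 := by
      refine (bergmanNorm_twistCoeff_le hp hc y b).trans (le_of_eq ?_)
      rw [hce, ENNReal.inv_mul_cancel h0 hN]
    have hmem : twistCoeff c y b ∈ bergmanSpaceInfty p μ :=
      ⟨by simp [twistCoeff, hb.1], hle.trans_lt ENNReal.one_lt_top⟩
    have h1 : ‖c * g (t + y * Complex.I)‖ₑ ≤ bergmanInftyEvalNorm p μ t :=
      le_iSup₂_of_le (twistCoeff c y b) (fun s => c * g (s + y * Complex.I))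
        (le_iSup₂_of_le hmem hle (le_iSup_of_le (hg.twist hc y) le_rfl))
    rw [enorm_mul, hce, mul_comm, ← div_eq_mul_inv, ENNReal.div_le_iff h0 hN] at h1
    exact h1

end

/-! ### Primitives and integration along horizontal half-lines. -/

/-- Holomorphic functions on a half-plane have primitives. -/
theorem exists_primitive_re_gt {c : ℝ} {g : ℂ → ℂ} (hg : DifferentiableOn ℂ g {s | c < s.re}) :
    ∃ f : ℂ → ℂ, ∀ z : ℂ, c < z.re → HasDerivAt f (g z) z := by
  -- These increasing discs are tangent to the line `Re s = c` and exhaust the half-plane.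
  -- Primitives on them that vanish at the common point `c + 1` are compatible.
  let B : ℕ → Set ℂ := fun n => Metric.ball ((c + n + 1 : ℝ) : ℂ) (n + 1)
  have hBsub : ∀ n, B n ⊆ {s | c < s.re} := by
    intro n z hz
    have h1 : ‖z - ((c + n + 1 : ℝ) : ℂ)‖ < n + 1 := by simpa [B, dist_eq_norm] using hz
    have h2 := (abs_le.1 (Complex.abs_re_le_norm (z - ((c + n + 1 : ℝ) : ℂ)))).1
    simp only [Complex.sub_re, Complex.ofReal_re] at h2
    simp only [mem_ofPred_eq]
    linarith
  have hBmono : Monotone B := by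
    intro m n hmn
    refine Metric.ball_subset_ball' ?_
    rw [dist_eq_norm, ← Complex.ofReal_sub, Complex.norm_real, Real.norm_eq_abs]
    have : (m : ℝ) ≤ n := by exact_mod_cast hmn
    rw [abs_of_nonpos (by linarith)]
    linarith
  have hBex : ∀ z : ℂ, c < z.re → ∃ n, z ∈ B n := by
    intro z hz
    -- With `x = Re z - c` and `y = Im z`, membership in `B n` means `x² + y² < 2(n + 1)x`.
    obtain ⟨n, hn⟩ := exists_nat_gt ((z.im ^ 2 + (z.re - c) ^ 2) / (z.re - c))
    refine ⟨n, ?_⟩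
    have hx : 0 < z.re - c := by linarith
    rw [div_lt_iff₀ hx] at hn
    simp only [B, Metric.mem_ball, dist_eq_norm]
    refine lt_of_pow_lt_pow_left₀ 2 (by positivity) ?_
    rw [← Complex.normSq_eq_norm_sq, Complex.normSq_apply]
    simp only [Complex.sub_re, Complex.ofReal_re, Complex.sub_im, Complex.ofReal_im]
    nlinarith [Nat.cast_nonneg (α := ℝ) n]
  have hprim : ∀ n, ∃ F : ℂ → ℂ, F ((c + 1 : ℝ) : ℂ) = 0 ∧ ∀ z ∈ B n, HasDerivAt F (g z) z :=
    fun n => (hg.mono (hBsub n)).isExactOn_ball.with_val_at _ 0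
  choose F hF0 hF using hprim
  have hx0 : ∀ n, ((c + 1 : ℝ) : ℂ) ∈ B n := fun n => hBmono (Nat.zero_le n) (by simp [B])
  have hFeq : ∀ m n, m ≤ n → EqOn (F m) (F n) (B m) := by
    intro m n hmn
    refine Metric.isOpen_ball.eqOn_of_deriv_eq (convex_ball _ _).isPreconnected
      (fun z hz => (hF m z hz).differentiableAt.differentiableWithinAt)
      (fun z hz => (hF n z (hBmono hmn hz)).differentiableAt.differentiableWithinAt)
      (fun z hz => ?_) (hx0 m) (by rw [hF0, hF0])
    rw [(hF m z hz).deriv, (hF n z (hBmono hmn hz)).deriv]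
  have hN : ∀ z : ℂ, ∃ n, c < z.re → z ∈ B n := by
    intro z
    by_cases hz : c < z.re
    · obtain ⟨n, hn⟩ := hBex z hz
      exact ⟨n, fun _ => hn⟩
    · exact ⟨0, fun h => absurd h hz⟩
  choose N hN using hN
  have hval : ∀ n, ∀ z ∈ B n, F (N z) z = F n z := by
    intro n z hz
    have hzN := hN z (hBsub n hz)
    rcases le_total (N z) n with h | h
    · exact hFeq _ _ h hzN
    · exact (hFeq _ _ h hz).symm
  refine ⟨fun z => F (N z) z, fun z hz => ?_⟩
  refine (hF (N z) z (hN z hz)).congr_of_eventuallyEq ?_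
  filter_upwards [Metric.isOpen_ball.mem_nhds (hN z hz)] with w hw
  exact hval _ w hw

theorem derivCoeff_one (a : ℕ → ℂ) : derivCoeff a 1 = 0 := by
  simp [derivCoeff, LSeries.logMul]

theorem abscissaOfAbsConv_derivCoeff (a : ℕ → ℂ) :
    LSeries.abscissaOfAbsConv (derivCoeff a) = LSeries.abscissaOfAbsConv a := by
  rw [← LSeries.abscissaOfAbsConv_logMul (f := a)]
  unfold LSeries.abscissaOfAbsConv
  simp only [derivCoeff, LSeriesSummable.neg_iff]

/-- A Dirichlet series extends to the half-plane as soon as its derivative does. -/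
theorem exists_isFunctionOf_of_derivCoeff {a : ℕ → ℂ} {g : ℂ → ℂ}
    (ha : LSeries.abscissaOfAbsConv a < ⊤) (hg : IsFunctionOf (derivCoeff a) g) :
    ∃ f, IsFunctionOf a f ∧ ∀ z : ℂ, 1 / 2 < z.re → HasDerivAt f (g z) z := by
  obtain ⟨F, hF⟩ := exists_primitive_re_gt hg.2.1
  obtain ⟨R, hR⟩ := exists_real_gt_abscissa ha
  set c := max (1 / 2) R
  have hc : ∀ z : ℂ, c < z.re → 1 / 2 < z.re ∧ LSeries.abscissaOfAbsConv a < z.re := fun z hz =>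
    ⟨(le_max_left _ _).trans_lt hz, hR.trans (by exact_mod_cast (le_max_right _ _).trans_lt hz)⟩
  set z₀ : ℂ := ((c + 1 : ℝ) : ℂ)
  have hz₀ : c < z₀.re := by simp [z₀]
  -- The additive constant makes the primitive agree with the series at one point of the half-plane
  -- of convergence.
  set d := LSeries a z₀ - F z₀
  have hfd : ∀ z : ℂ, 1 / 2 < z.re → HasDerivAt (fun z => F z + d) (g z) z := fun z hz =>
    (hF z hz).add_const d
  refine ⟨fun z => F z + d, isFunctionOf_of_eventually (R := c) ha
    (fun z hz => (hfd z hz).differentiableAt.differentiableWithinAt) fun s _ hs => ?_, hfd⟩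
  refine (isOpen_re_gt c).eqOn_of_deriv_eq (f := fun z => F z + d) (g := LSeries a)
    (convex_halfSpace_re_gt c).isPreconnected
    (fun z hz => (hfd z (hc z hz).1).differentiableAt.differentiableWithinAt)
    (fun z hz => (LSeries_hasDerivAt (hc z hz).2).differentiableAt.differentiableWithinAt)
    (fun z hz => ?_) hz₀ (by simp [d]) hs
  rw [(hfd z (hc z hz).1).deriv, LSeries_deriv (hc z hz).2,
    hg.2.2 z (hc z hz).1 (by rw [abscissaOfAbsConv_derivCoeff]; exact (hc z hz).2),
    derivCoeff, LSeries_neg]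

/-- A vertical twist reduces the limit along `Im s = y` to the limit along the real axis and leaves
`a₁` unchanged, since `1^{-iy} = 1`. -/
theorem IsFunctionOf.tendsto_atTop {a : ℕ → ℂ} {f : ℂ → ℂ} (hf : IsFunctionOf a f) (y : ℝ) :
    Tendsto (fun T : ℝ => f (T + y * Complex.I)) atTop (𝓝 (a 1)) := by
  have h1 := hf.twist one_ne_zero y
  have h2 := LSeries.tendsto_atTop h1.1
  obtain ⟨R, hR⟩ := exists_real_gt_abscissa h1.1
  have h3 : twistCoeff 1 y a 1 = a 1 := by simp [twistCoeff]
  rw [h3] at h2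
  refine h2.congr' ?_
  filter_upwards [eventually_gt_atTop R, eventually_gt_atTop (1 / 2)] with T hT hT2
  have := h1.2.2 (T : ℂ) (by simpa using hT2) (hR.trans (by exact_mod_cast hT))
  rw [← this]
  exact one_mul _

/-- The fundamental theorem of calculus on the segment from `s` to `T + i Im s`, followed by `T →
∞`. The integral may be infinite. -/
theorem IsFunctionOf.enorm_le_add_lintegral {a : ℕ → ℂ} {f g : ℂ → ℂ} (hf : IsFunctionOf a f)
    (hg : DifferentiableOn ℂ g {s : ℂ | 1 / 2 < s.re})
    (hfg : ∀ z : ℂ, 1 / 2 < z.re → HasDerivAt f (g z) z) {s : ℂ} (hs : 1 / 2 < s.re) :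
    ‖f s‖ₑ ≤ ‖a 1‖ₑ + ∫⁻ t in Ioi s.re, ‖g (t + s.im * Complex.I)‖ₑ := by
  have hlim : Tendsto (fun T : ℝ => ‖f (T + s.im * Complex.I)‖ₑ +
      ∫⁻ t in Ioi s.re, ‖g (t + s.im * Complex.I)‖ₑ) atTop
      (𝓝 (‖a 1‖ₑ + ∫⁻ t in Ioi s.re, ‖g (t + s.im * Complex.I)‖ₑ)) :=
    ((continuous_enorm.tendsto _).comp (hf.tendsto_atTop s.im)).add_const _
  refine ge_of_tendsto hlim ?_
  filter_upwards [eventually_ge_atTop s.re] with T hT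
  have hcont : ContinuousOn (fun t : ℝ => g (t + s.im * Complex.I)) (uIcc s.re T) := by
    refine hg.continuousOn.comp (by fun_prop) fun t ht => ?_
    rw [uIcc_of_le hT] at ht
    simpa using hs.trans_le ht.1
  have hderiv : ∀ t ∈ uIcc s.re T, HasDerivAt (fun t : ℝ => f (t + s.im * Complex.I))
      (g (t + s.im * Complex.I)) t := by
    intro t ht
    rw [uIcc_of_le hT] at ht
    have h1 := hfg (t + s.im * Complex.I) (by simpa using hs.trans_le ht.1)
    exact (h1.comp_add_const (t : ℂ) (s.im * Complex.I)).comp_ofReal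
  have h := intervalIntegral.integral_eq_sub_of_hasDerivAt hderiv hcont.intervalIntegrable
  rw [Complex.re_add_im] at h
  have h2 : f s = f (T + s.im * Complex.I) - ∫ t in s.re..T, g (t + s.im * Complex.I) := by
    rw [h]
    ring
  calc ‖f s‖ₑ ≤ ‖f (T + s.im * Complex.I)‖ₑ + ‖∫ t in s.re..T, g (t + s.im * Complex.I)‖ₑ := by
        rw [h2]
        exact enorm_sub_le
    _ ≤ _ := by
        gcongr
        rw [intervalIntegral.integral_of_le hT]
        exact (enorm_integral_le_lintegral_enorm _).trans
          (lintegral_mono_set Ioc_subset_Ioi_self)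

/-- The source of the constant `2^{1/p'}`: convexity gives `x + N ≤ 2^{1-1/p} (x^p + N^p)^{1/p}`. -/
theorem add_mul_le_two_rpow_mul {p : ℝ} (hp : 1 ≤ p) (x I N : ℝ≥0∞) :
    x + I * N ≤ 2 ^ (1 - 1 / p) * max 1 I * (x ^ p + N ^ p) ^ (1 / p) := by
  have hp0 : 0 < p := by linarith
  have h1 : x + I * N ≤ max 1 I * (x + N) := by
    rw [mul_add]
    gcongr
    · exact le_mul_of_one_le_left' (le_max_left _ _)
    · exact le_max_right _ _
  have h2 : x + N ≤ 2 ^ (1 - 1 / p) * (x ^ p + N ^ p) ^ (1 / p) := by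
    have h := ENNReal.rpow_le_rpow (ENNReal.rpow_add_le_mul_rpow_add_rpow x N hp)
      (z := 1 / p) (by positivity)
    rw [← ENNReal.rpow_mul, mul_one_div_cancel hp0.ne', ENNReal.rpow_one,
      ENNReal.mul_rpow_of_nonneg _ _ (by positivity), ← ENNReal.rpow_mul] at h
    convert h using 3
    field_simp
  calc x + I * N ≤ max 1 I * (2 ^ (1 - 1 / p) * (x ^ p + N ^ p) ^ (1 / p)) := h1.trans (by gcongr)
    _ = _ := by ring

theorem measure_Ioo_zero_ne_zero {μ : Measure ℝ} (h0 : μ (Iic 0) = 0)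
    (hsupp : (0 : ℝ) ∈ μ.support) {ε : ℝ} (hε : 0 < ε) : μ (Ioo 0 ε) ≠ 0 := by
  have h1 : 0 < μ (Iio ε) := (Measure.mem_support_iff_forall _).1 hsupp _ (Iio_mem_nhds hε)
  intro h
  have h2 : μ (Iio ε) ≤ μ (Iic 0) + μ (Ioo 0 ε) := by
    refine (measure_mono fun x hx => ?_).trans (measure_union_le _ _)
    rcases le_or_gt x 0 with h | h
    · exact Or.inl h
    · exact Or.inr ⟨h, hx⟩
  rw [h0, h, add_zero] at h2
  exact h1.not_ge h2

/-- Only finiteness of `μ` and its charging every `(0, ε)` matter, so the same statement serves both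
parts of the theorem. -/
theorem exists_isFunctionOf_enorm_le_dirichletNorm {p : ℝ} {μ : Measure ℝ} [IsFiniteMeasure μ]
    (hp : 1 ≤ p) (hμ : ∀ ε : ℝ, 0 < ε → μ (Ioo 0 ε) ≠ 0) {a : ℕ → ℂ}
    (ha : a ∈ dirichletSpace p μ) :
    ∃ f : ℂ → ℂ, IsFunctionOf a f ∧ ∀ s : ℂ, 1 / 2 < s.re →
      ‖f s‖ₑ ≤ (2 : ℝ≥0∞) ^ (1 - 1 / p) *
        max 1 (∫⁻ t : ℝ in Ioi s.re, bergmanInftyEvalNorm p μ (t : ℂ)) * dirichletNorm p μ a := by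
  have hp0 : 0 < p := by linarith
  have hb : bergmanNorm p μ (derivCoeff a) < ∞ := by
    have h := ha.2
    rw [dirichletNorm, ENNReal.rpow_lt_top_iff_of_pos (by positivity), ENNReal.add_lt_top,
      ENNReal.rpow_lt_top_iff_of_pos hp0 (x := bergmanNorm p μ (derivCoeff a))] at h
    exact h.2
  have hbV : derivCoeff a ∈ bergmanSpaceInfty p μ := ⟨derivCoeff_one a, hb⟩
  obtain ⟨g, hg⟩ := exists_isFunctionOf_of_bergmanNorm_lt_top hp hμ hb
  obtain ⟨f, hf, hfg⟩ := exists_isFunctionOf_of_derivCoeff ha.1 hg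
  refine ⟨f, hf, fun s hs => (hf.enorm_le_add_lintegral hg.2.1 hfg hs).trans ?_⟩
  refine le_trans ?_ (add_mul_le_two_rpow_mul hp _ _ _)
  gcongr
  rw [← lintegral_mul_const' _ _ hb.ne]
  exact setLIntegral_mono' measurableSet_Ioi fun t ht =>
    hg.enorm_le_evalNorm hp hμ hbV (hs.trans ht) s.im

/-! ### Point evaluations for the measures `μ_α`. -/

section

variable {α p : ℝ}

theorem isFiniteMeasure_muAlpha (hα : -1 < α) : IsFiniteMeasure (muAlpha α) := by
  have hΓ := Real.Gamma_pos_of_pos (show 0 < α + 1 by linarith)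
  refine ⟨?_⟩
  rw [muAlpha, withDensity_apply _ MeasurableSet.univ, Measure.restrict_univ]
  -- Integrability follows from the nonzero Gamma integral, because the integral of a non-integrable
  -- function is `0` by convention.
  have h1 : ∫ t in Ioi (0 : ℝ), t ^ α * Real.exp (-(2 * t)) ≠ 0 := by
    have := Real.integral_rpow_mul_exp_neg_mul_Ioi (show 0 < α + 1 by linarith)
      (zero_lt_two (α := ℝ))
    rw [add_sub_cancel_right] at this
    rw [this]
    positivity
  have h2 : IntegrableOn (fun t : ℝ => t ^ α * Real.exp (-(2 * t))) (Ioi 0) := by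
    by_contra h
    exact h1 (integral_undef h)
  have h3 : ∫⁻ σ : ℝ, ENNReal.ofReal
      (if 0 < σ then 2 ^ (α + 1) / Real.Gamma (α + 1) * σ ^ α * Real.exp (-2 * σ) else 0)
      = ∫⁻ σ in Ioi (0 : ℝ), ENNReal.ofReal
          (2 ^ (α + 1) / Real.Gamma (α + 1) * (σ ^ α * Real.exp (-(2 * σ)))) := by
    rw [← lintegral_indicator measurableSet_Ioi]
    refine lintegral_congr fun σ => ?_
    by_cases hσ : 0 < σ
    · simp [hσ, mul_assoc]
    · simp [hσ]
  rw [h3]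
  exact (h2.const_mul _).lintegral_lt_top

/-- On `(ε/2, ε)`, an interval of length `ε/2`, one has `σ^α ≥ 2^{-|α|} ε^α` whatever the sign of
`α`, and `e^{-2σ} ≥ e^{-4}` because `ε ≤ 2`. -/
theorem exists_le_muAlpha_Ioo (hα : -1 < α) :
    ∃ κ : ℝ, 0 < κ ∧ ∀ ε : ℝ, 0 < ε → ε ≤ 2 →
      ENNReal.ofReal (κ * ε ^ (α + 1)) ≤ muAlpha α (Ioo 0 ε) := by
  have hΓ := Real.Gamma_pos_of_pos (show 0 < α + 1 by linarith)
  set C := (2 : ℝ) ^ (α + 1) / Real.Gamma (α + 1) with hC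
  have hC0 : 0 < C := by positivity
  refine ⟨C * (1 / 2) ^ |α| * Real.exp (-4) / 2, by positivity, fun ε hε hε2 => ?_⟩
  have h1 : ∀ σ ∈ Ioo (ε / 2) ε, ENNReal.ofReal (C * ((1 / 2) ^ |α| * ε ^ α) * Real.exp (-4))
      ≤ ENNReal.ofReal (if 0 < σ then C * σ ^ α * Real.exp (-2 * σ) else 0) := by
    intro σ hσ
    have hσ0 : 0 < σ := by linarith [hσ.1]
    rw [if_pos hσ0]
    have h2 : (1 / 2) ^ |α| * ε ^ α ≤ σ ^ α := by
      have hu : σ = σ / ε * ε := by field_simp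
      have hu0 : 1 / 2 ≤ σ / ε := by
        rw [le_div_iff₀ hε]
        linarith [hσ.1]
      have hu1 : σ / ε ≤ 1 := (div_le_one hε).2 hσ.2.le
      conv_rhs => rw [hu, Real.mul_rpow (by positivity) hε.le]
      gcongr
      exact (Real.rpow_le_rpow (by norm_num) hu0 (abs_nonneg α)).trans
        (Real.rpow_le_rpow_of_exponent_ge (by positivity) hu1 (le_abs_self α))
    have h3 : Real.exp (-4) ≤ Real.exp (-2 * σ) := Real.exp_le_exp.2 (by linarith [hσ.2])
    gcongr
  calc ENNReal.ofReal (C * (1 / 2) ^ |α| * Real.exp (-4) / 2 * ε ^ (α + 1))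
      = ENNReal.ofReal (C * ((1 / 2) ^ |α| * ε ^ α) * Real.exp (-4)) * volume (Ioo (ε / 2) ε) := by
        rw [Real.volume_Ioo, ← ENNReal.ofReal_mul (by positivity), Real.rpow_add hε, Real.rpow_one]
        congr 1
        ring
    _ ≤ ∫⁻ σ in Ioo (ε / 2) ε,
          ENNReal.ofReal (if 0 < σ then C * σ ^ α * Real.exp (-2 * σ) else 0) := by
        rw [← setLIntegral_const]
        exact setLIntegral_mono' measurableSet_Ioo h1
    _ ≤ ∫⁻ σ in Ioo 0 ε,
          ENNReal.ofReal (if 0 < σ then C * σ ^ α * Real.exp (-2 * σ) else 0) :=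
        lintegral_mono_set (Ioo_subset_Ioo_left (by linarith))
    _ = muAlpha α (Ioo 0 ε) := by
        rw [muAlpha, withDensity_apply _ measurableSet_Ioo]

theorem muAlpha_Ioo_ne_zero (hα : -1 < α) {ε : ℝ} (hε : 0 < ε) : muAlpha α (Ioo 0 ε) ≠ 0 := by
  obtain ⟨κ, hκ, h⟩ := exists_le_muAlpha_Ioo hα
  have hm : 0 < min ε 2 := lt_min hε two_pos
  have h1 := h (min ε 2) hm (min_le_right _ _)
  have h2 : 0 < ENNReal.ofReal (κ * (min ε 2) ^ (α + 1)) := ENNReal.ofReal_pos.2 (by positivity)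
  exact (h2.trans_le (h1.trans (measure_mono (Ioo_subset_Ioo_right (min_le_left _ _))))).ne'

/-- Near `1` this is the simple pole of `ζ`: `(x - 1)ζ(x) → 1`, hence it is below `2`. Away from `1`
the sum is bounded by monotonicity, and `ε ≤ 2` bounds the product with `ε`. -/
theorem exists_tsum_rpow_le :
    ∃ C : ℝ, 0 < C ∧ ∀ ε : ℝ, 0 < ε → ε ≤ 2 → ∑' n : ℕ, (n : ℝ) ^ (-(1 + 2 * ε)) ≤ C / ε := by
  have h := tendsto_sub_mul_tsum_nat_rpow.eventually (eventually_lt_nhds one_lt_two)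
  obtain ⟨x, hx, hx2⟩ := mem_nhdsGT_iff_exists_Ioo_subset.1 h
  have hx1 : (1 : ℝ) < x := hx
  set y := (1 + x) / 2 with hy
  set B := ∑' n : ℕ, (n : ℝ) ^ (-y) with hB
  have hB0 : 0 ≤ B := tsum_nonneg fun n => Real.rpow_nonneg (Nat.cast_nonneg n) _
  refine ⟨1 + 2 * B, by positivity, fun ε hε hε2 => ?_⟩
  rw [le_div_iff₀ hε]
  rcases lt_or_ge (1 + 2 * ε) y with hlt | hge
  · have h1 : (1 + 2 * ε - 1) * ∑' n : ℕ, 1 / (n : ℝ) ^ (1 + 2 * ε) < 2 :=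
      hx2 ⟨by linarith, by linarith⟩
    simp only [one_div, ← Real.rpow_neg (Nat.cast_nonneg _)] at h1
    linarith
  · have h1 : ∑' n : ℕ, (n : ℝ) ^ (-(1 + 2 * ε)) ≤ B := by
      refine Summable.tsum_le_tsum (fun n => ?_) (Real.summable_nat_rpow.2 (by linarith))
        (Real.summable_nat_rpow.2 (by linarith))
      rcases Nat.eq_zero_or_pos n with rfl | hn
      · rw [Nat.cast_zero, Real.zero_rpow (by linarith), Real.zero_rpow (by linarith)]
      · exact Real.rpow_le_rpow_of_exponent_le (by exact_mod_cast hn) (by linarith)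
    nlinarith

/-- Point evaluations on `A^p_α` near the line `Re s = 1/2`. -/
theorem exists_bergmanInftyEvalNorm_muAlpha_le (hp : 1 ≤ p) (hα : -1 < α) :
    ∃ C : ℝ, 0 < C ∧ ∀ t : ℝ, 1 / 2 < t → t ≤ 3 →
      bergmanInftyEvalNorm p (muAlpha α) t
        ≤ ENNReal.ofReal (C * (2 * t - 1) ^ (-((2 + α) / p))) := by
  have hp0 : 0 < p := by linarith
  have := isFiniteMeasure_muAlpha hα
  obtain ⟨κ, hκ, hμ⟩ := exists_le_muAlpha_Ioo hα
  obtain ⟨Z, hZ, hζ⟩ := exists_tsum_rpow_le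
  refine ⟨(Z / κ * 4 ^ (2 + α)) ^ (1 / p), by positivity, fun t ht ht3 => ?_⟩
  set δ := 2 * t - 1 with hδ
  have hδ0 : 0 < δ := by linarith
  -- This is the largest admissible `ε`: `1/2 + 2ε = t`. The factors `ε^{-1}` from `ζ` and
  -- `ε^{-(α+1)}` from the measure combine to `ε^{-(2+α)}`.
  set ε := δ / 4 with hεdef
  have hε : 0 < ε := by positivity
  refine (bergmanInftyEvalNorm_le hp (fun ε hε => muAlpha_Ioo_ne_zero hα hε) hε (s := t)
    (by simp only [Complex.ofReal_re]; linarith)).trans ?_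
  have h1 : ENNReal.ofReal (∑' n : ℕ, (n : ℝ) ^ (-(1 + 2 * ε))) / muAlpha α (Ioo 0 ε)
      ≤ ENNReal.ofReal (Z / κ * 4 ^ (2 + α) * δ ^ (-(2 + α))) := by
    calc _ ≤ ENNReal.ofReal (Z / ε) / ENNReal.ofReal (κ * ε ^ (α + 1)) := by
          gcongr
          · exact hζ ε hε (by linarith)
          · exact hμ ε hε (by linarith)
      _ = _ := by
          rw [← ENNReal.ofReal_div_of_pos (by positivity)]
          congr 1
          rw [Real.rpow_neg hδ0.le, show α + 1 = (2 + α) - 1 by ring, Real.rpow_sub_one hε.ne',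
            hεdef, Real.div_rpow hδ0.le (by norm_num)]
          field_simp
  rw [bergmanEvalConst]
  refine (ENNReal.rpow_le_rpow h1 (by positivity)).trans (le_of_eq ?_)
  rw [ENNReal.ofReal_rpow_of_nonneg (by positivity) (by positivity),
    Real.mul_rpow (by positivity) (by positivity), ← Real.rpow_mul hδ0.le]
  congr 3
  ring

/-- Point evaluations on `A^p_{μ,∞}` decay exponentially. -/
theorem exists_bergmanInftyEvalNorm_le_exp {μ : Measure ℝ} [IsFiniteMeasure μ] (hp : 1 ≤ p)
    (hμ : μ (Ioo 0 1) ≠ 0) :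
    ∃ C : ℝ, ∀ t : ℝ, 3 < t →
      bergmanInftyEvalNorm p μ t ≤ ENNReal.ofReal (C * Real.exp (-Real.log 2 * t)) := by
  set A : ℝ≥0∞ := (1 / μ (Ioo 0 1)) ^ (1 / p) with hA
  have hAtop : A ≠ ∞ := ENNReal.rpow_ne_top_of_nonneg (by positivity)
    (ENNReal.div_ne_top ENNReal.one_ne_top hμ)
  -- For `n ≥ 2` and `t > 3`, `n^{-t} ≤ n^{-3} 2^{3-t} = 8 n^{-3} 2^{-t}`; with `|b_n| ≤ A n` this
  -- leaves the summable `8 A n^{-2}`.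
  refine ⟨∑' n : ℕ, A.toReal * 8 * (n : ℝ) ^ (-2 : ℝ), fun t ht => ?_⟩
  have hsum : Summable fun n : ℕ => (n : ℝ) ^ (-2 : ℝ) := Real.summable_nat_rpow.2 (by norm_num)
  refine iSup₂_le fun b g => iSup₂_le fun hbV hb1 => iSup_le fun hg => ?_
  have hcoeff : ∀ n : ℕ, n ≠ 0 → ‖b n‖ ≤ A.toReal * n := by
    intro n hn
    have h1 := (enorm_coeff_le_bergmanNorm hp hμ hbV.2 ⟨n, Nat.pos_of_ne_zero hn⟩).trans
      (mul_le_mul_right hb1 A)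
    have hn' : (0 : ℝ) < n := by exact_mod_cast Nat.pos_of_ne_zero hn
    rw [mul_one, ← ENNReal.ofReal_toReal hAtop, ← ofReal_norm,
      ENNReal.ofReal_le_ofReal_iff ENNReal.toReal_nonneg, norm_div, PNat.mk_coe,
      Complex.norm_natCast, div_le_iff₀ hn'] at h1
    exact h1
  have habs : LSeries.abscissaOfAbsConv b < (t : ℂ).re := by
    refine (LSeries.abscissaOfAbsConv_le_of_le_const_mul_rpow (x := 1)
      ⟨A.toReal, fun n hn => by simpa using hcoeff n hn⟩).trans_lt ?_
    rw [Complex.ofReal_re]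
    exact_mod_cast (by linarith : (1 : ℝ) + 1 < t)
  rw [hg.2.2 t (by simp only [Complex.ofReal_re]; linarith) habs, ← ofReal_norm]
  refine ENNReal.ofReal_le_ofReal ?_
  rw [← tsum_mul_right]
  refine tsum_of_norm_bounded ((hsum.mul_left _).mul_right _).hasSum fun n => ?_
  rcases eq_or_ne n 0 with rfl | hn
  · rw [LSeries.term_zero, norm_zero]
    positivity
  -- The vanishing constant coefficient is essential here: the term `n = 1` would not decay.
  rcases eq_or_ne n 1 with rfl | hn1
  · rw [LSeries.term_of_ne_zero one_ne_zero, hbV.1, zero_div, norm_zero]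
    positivity
  have hn0 : (0 : ℝ) < n := by exact_mod_cast Nat.pos_of_ne_zero hn
  have hn2 : (2 : ℝ) ≤ n := by exact_mod_cast (show 2 ≤ n by omega)
  rw [LSeries.norm_term_eq, if_neg hn, Complex.ofReal_re, div_le_iff₀ (by positivity)]
  refine (hcoeff n hn).trans ?_
  have h1 : (2 : ℝ) ^ (t - 3) ≤ (n : ℝ) ^ (t - 3) :=
    Real.rpow_le_rpow two_pos.le hn2 (by linarith)
  have h2 : Real.exp (-Real.log 2 * t) = ((2 : ℝ) ^ t)⁻¹ := by
    rw [Real.rpow_def_of_pos two_pos, ← Real.exp_neg, neg_mul]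
  have h3 : (2 : ℝ) ^ (t - 3) = 2 ^ t / 8 := by
    rw [Real.rpow_sub two_pos]
    norm_num
  have h4 : (n : ℝ) ^ t = n ^ (t - 3) * n ^ 3 := by
    rw [← Real.rpow_natCast, ← Real.rpow_add hn0]
    congr 1
    push_cast
    ring
  have h5 : (n : ℝ) ^ (-2 : ℝ) = ((n : ℝ) ^ 2)⁻¹ := by
    rw [Real.rpow_neg hn0.le]
    norm_num
  have h6 : (0 : ℝ) < 2 ^ t := by positivity
  rw [h3] at h1
  rw [h2, h4, h5]
  calc A.toReal * n = A.toReal * 8 * ((n : ℝ) ^ 2)⁻¹ * (2 ^ t)⁻¹ * (2 ^ t / 8 * n ^ 3) := by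
        field_simp
    _ ≤ _ := by gcongr

/-! ### Integration of the evaluation norms. -/

/-- The integral which governs the point evaluations on `D^p_α`. -/
noncomputable def evalIntegral (β δ : ℝ) : ℝ := ∫ u in min δ 5..5, u ^ (-β)

/-- The substitution `u = 2t - 1` sends `t = 3` to `5`; the minimum in `evalIntegral` makes both
sides vanish when `σ > 3`. -/
theorem lintegral_Ioc_eq_evalIntegral {C β σ : ℝ} (hC : 0 < C) (hσ : 1 / 2 < σ) :
    ∫⁻ t in Ioc σ 3, ENNReal.ofReal (C * (2 * t - 1) ^ (-β))
      = ENNReal.ofReal (C / 2 * evalIntegral β (2 * σ - 1)) := by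
  rcases lt_or_ge 3 σ with h3 | h3
  · rw [Ioc_eq_empty (by linarith), evalIntegral, min_eq_right (by linarith)]
    simp
  · have hcont : ContinuousOn (fun t : ℝ => C * (2 * t - 1) ^ (-β)) (uIcc σ 3) := by
      rw [uIcc_of_le h3]
      refine continuousOn_const.mul (ContinuousOn.rpow_const (by fun_prop) fun t ht => Or.inl ?_)
      linarith [ht.1]
    rw [← ofReal_integral_eq_lintegral_ofReal, ← intervalIntegral.integral_of_le h3,
      intervalIntegral.integral_const_mul,
      intervalIntegral.integral_comp_mul_sub (fun u : ℝ => u ^ (-β)) two_ne_zero,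
      evalIntegral, min_eq_left (by linarith)]
    · norm_num
      ring_nf
    · exact (intervalIntegrable_iff_integrableOn_Ioc_of_le h3).1 hcont.intervalIntegrable
    · refine (ae_restrict_iff' measurableSet_Ioc).2 (Eventually.of_forall fun t ht => ?_)
      have : 0 < 2 * t - 1 := by linarith [ht.1]
      simp only [Pi.zero_apply]
      positivity

theorem evalIntegral_nonneg (β : ℝ) {δ : ℝ} (hδ : 0 < δ) : 0 ≤ evalIntegral β δ :=
  intervalIntegral.integral_nonneg (min_le_right _ _) fun _ hu =>
    Real.rpow_nonneg ((lt_min hδ (by norm_num)).le.trans hu.1) _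

theorem evalIntegral_eq {β δ : ℝ} (hβ : β ≠ 1) (hδ : 0 < δ) :
    evalIntegral β δ = (5 ^ (1 - β) - min δ 5 ^ (1 - β)) / (1 - β) := by
  have h0 : (0 : ℝ) ∉ uIcc (min δ 5) 5 := by
    rw [uIcc_of_le (min_le_right _ _)]
    exact fun h => (lt_min hδ (by norm_num)).not_ge h.1
  rw [evalIntegral, integral_rpow (Or.inr ⟨fun h => hβ (by linarith), h0⟩),
    show -β + 1 = 1 - β by ring]

theorem evalIntegral_le_of_one_lt {β δ : ℝ} (hβ : 1 < β) (hδ : 0 < δ) :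
    evalIntegral β δ ≤ 1 / (β - 1) * max 1 (δ ^ (1 - β)) := by
  have hβ0 : 0 < β - 1 := by linarith
  rcases le_total δ 5 with h | h
  · rw [evalIntegral_eq hβ.ne' hδ, min_eq_left h, ← neg_div_neg_eq, neg_sub, neg_sub, one_div,
      inv_mul_eq_div]
    gcongr
    refine le_trans ?_ (le_max_right _ _)
    have : (0 : ℝ) ≤ 5 ^ (1 - β) := by positivity
    linarith
  · rw [evalIntegral, min_eq_right h, intervalIntegral.integral_same]
    positivity

theorem evalIntegral_le_of_lt_one {β δ : ℝ} (hβ : β < 1) (hδ : 0 < δ) :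
    evalIntegral β δ ≤ 5 ^ (1 - β) / (1 - β) := by
  have hβ0 : 0 < 1 - β := by linarith
  rw [evalIntegral_eq hβ.ne hδ]
  gcongr
  have : 0 < min δ 5 := lt_min hδ (by norm_num)
  have : 0 ≤ min δ 5 ^ (1 - β) := by positivity
  linarith

theorem evalIntegral_one_le {δ : ℝ} (hδ : 0 < δ) :
    evalIntegral 1 δ ≤ (1 + Real.log 5) * max 1 (Real.log (1 / δ)) := by
  have h5 : 0 ≤ Real.log 5 := Real.log_nonneg (by norm_num)
  have h1 := le_max_left 1 (Real.log (1 / δ))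
  rcases le_total δ 5 with h | h
  · have h2 : evalIntegral 1 δ = Real.log 5 + Real.log (1 / δ) := by
      rw [evalIntegral, min_eq_left h]
      simp only [Real.rpow_neg_one]
      rw [integral_inv_of_pos hδ (by norm_num), ← Real.log_mul (by norm_num) (by positivity)]
      ring_nf
    have h3 := le_max_right 1 (Real.log (1 / δ))
    rw [h2]
    nlinarith
  · rw [evalIntegral, min_eq_right h, intervalIntegral.integral_same]
    positivity

theorem exists_lintegral_bergmanInftyEvalNorm_le (hp : 1 ≤ p) (hα : -1 < α) :
    ∃ D : ℝ, 0 < D ∧ ∀ σ : ℝ, 1 / 2 < σ →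
      ∫⁻ t : ℝ in Ioi σ, bergmanInftyEvalNorm p (muAlpha α) (t : ℂ)
        ≤ ENNReal.ofReal (D * (1 + evalIntegral ((2 + α) / p) (2 * σ - 1))) := by
  have := isFiniteMeasure_muAlpha hα
  obtain ⟨C, hC, hnear⟩ := exists_bergmanInftyEvalNorm_muAlpha_le hp hα
  obtain ⟨B, hfar⟩ := exists_bergmanInftyEvalNorm_le_exp hp (muAlpha_Ioo_ne_zero hα one_pos)
  have hfin : ∫⁻ t in Ioi (3 : ℝ), ENNReal.ofReal (B * Real.exp (-Real.log 2 * t)) < ∞ :=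
    ((exp_neg_integrableOn_Ioi 3 (Real.log_pos one_lt_two)).const_mul B).lintegral_lt_top
  set J := (∫⁻ t in Ioi (3 : ℝ), ENNReal.ofReal (B * Real.exp (-Real.log 2 * t))).toReal with hJ
  have hJ0 : 0 ≤ J := ENNReal.toReal_nonneg
  refine ⟨C / 2 + J, by positivity, fun σ hσ => ?_⟩
  have hΦ := evalIntegral_nonneg ((2 + α) / p) (δ := 2 * σ - 1) (by linarith)
  -- The power bound is used up to `3` and the exponential bound beyond; for `σ > 3` the first piece
  -- is empty and the second is merely enlarged.
  have hsub : Ioi σ ⊆ Ioc σ 3 ∪ Ioi 3 := fun t ht => (le_or_gt t 3).imp (fun h => ⟨ht, h⟩) id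
  calc ∫⁻ t : ℝ in Ioi σ, bergmanInftyEvalNorm p (muAlpha α) (t : ℂ)
      ≤ (∫⁻ t : ℝ in Ioc σ 3, bergmanInftyEvalNorm p (muAlpha α) (t : ℂ))
          + ∫⁻ t : ℝ in Ioi 3, bergmanInftyEvalNorm p (muAlpha α) (t : ℂ) :=
        (lintegral_mono_set hsub).trans (lintegral_union_le _ _ _)
    _ ≤ (∫⁻ t in Ioc σ 3, ENNReal.ofReal (C * (2 * t - 1) ^ (-((2 + α) / p))))
          + ∫⁻ t in Ioi (3 : ℝ), ENNReal.ofReal (B * Real.exp (-Real.log 2 * t)) :=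
        add_le_add
          (setLIntegral_mono' measurableSet_Ioc fun t ht => hnear t (hσ.trans ht.1) ht.2)
          (setLIntegral_mono' measurableSet_Ioi fun t ht => hfar t ht)
    _ = ENNReal.ofReal (C / 2 * evalIntegral ((2 + α) / p) (2 * σ - 1)) + ENNReal.ofReal J := by
        rw [lintegral_Ioc_eq_evalIntegral hC hσ, hJ, ENNReal.ofReal_toReal hfin.ne]
    _ ≤ _ := by
        rw [← ENNReal.ofReal_add (by positivity) hJ0]
        refine ENNReal.ofReal_le_ofReal ?_
        nlinarith [mul_nonneg hJ0 hΦ]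

theorem exists_dirichletEvalNorm_muAlpha_le (hp : 1 ≤ p) (hα : -1 < α) :
    ∃ D : ℝ, 0 < D ∧ ∀ s : ℂ, 1 / 2 < s.re →
      dirichletEvalNorm p (muAlpha α) s
        ≤ ENNReal.ofReal (D * (1 + evalIntegral ((2 + α) / p) (2 * s.re - 1))) := by
  have := isFiniteMeasure_muAlpha hα
  obtain ⟨D, hD, hint⟩ := exists_lintegral_bergmanInftyEvalNorm_le hp hα
  -- The factor `2` bounds `2^{1-1/p}`, and `max(1, D(1 + Φ)) ≤ (1 + D)(1 + Φ)` for the integral `Φ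
  -- ≥ 0`.
  refine ⟨2 * (1 + D), by positivity, fun s hs => ?_⟩
  refine iSup₂_le fun a f => iSup₂_le fun ha ha1 => iSup_le fun hf => ?_
  obtain ⟨f', hf', hle⟩ := exists_isFunctionOf_enorm_le_dirichletNorm hp
    (fun ε hε => muAlpha_Ioo_ne_zero hα hε) ha
  -- The norm runs over all representing functions, and uniqueness of the extension replaces `f` by
  -- the one already estimated.
  rw [hf.eq hf' hs]
  set Φ := evalIntegral ((2 + α) / p) (2 * s.re - 1)
  have hΦ : 0 ≤ Φ := evalIntegral_nonneg _ (by linarith)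
  have h2 : (2 : ℝ≥0∞) ^ (1 - 1 / p) ≤ 2 := by
    conv_rhs => rw [← ENNReal.rpow_one 2]
    exact ENNReal.rpow_le_rpow_of_exponent_le one_le_two (by
      have : 0 ≤ 1 / p := by positivity
      linarith)
  calc ‖f' s‖ₑ ≤ _ := hle s hs
    _ ≤ 2 * ENNReal.ofReal (1 + D * (1 + Φ)) * 1 := by
        gcongr
        refine max_le ?_ ((hint s.re hs).trans (ENNReal.ofReal_le_ofReal (by linarith)))
        rw [← ENNReal.ofReal_one]
        exact ENNReal.ofReal_le_ofReal (by nlinarith [mul_nonneg hD.le hΦ])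
    _ = ENNReal.ofReal (2 * (1 + D * (1 + Φ))) := by
        rw [ENNReal.ofReal_mul two_pos.le, mul_one, ENNReal.ofReal_ofNat]
    _ ≤ _ := ENNReal.ofReal_le_ofReal (by nlinarith)

end

theorem mainTheorem11 :
    (∀ (p : ℝ) (μ : Measure ℝ), 1 ≤ p → IsProbabilityMeasure μ → μ (Iic 0) = 0 →
      (0 : ℝ) ∈ μ.support →
      ∀ a ∈ dirichletSpace p μ, ∃ f : ℂ → ℂ, IsFunctionOf a f ∧
        ∀ s : ℂ, 1 / 2 < s.re →
          ‖f s‖ₑ ≤ (2 : ℝ≥0∞) ^ (1 - 1 / p) *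
            max 1 (∫⁻ t : ℝ in Ioi s.re, bergmanInftyEvalNorm p μ (t : ℂ)) *
              dirichletNorm p μ a) ∧
    (∀ p α : ℝ, 1 ≤ p → -1 < α →
      ∃ c : ℝ, 0 < c ∧ ∀ s : ℂ, 1 / 2 < s.re →
        (p - 2 < α → dirichletEvalNorm p (muAlpha α) s ≤
          ENNReal.ofReal (c * max 1 ((2 * s.re - 1) ^ (1 - (2 + α) / p)))) ∧
        (α = p - 2 → dirichletEvalNorm p (muAlpha α) s ≤
          ENNReal.ofReal (c * max 1 (Real.log (1 / (2 * s.re - 1))))) ∧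
        (α < p - 2 → dirichletEvalNorm p (muAlpha α) s ≤ ENNReal.ofReal c)) := by
  constructor
  · intro p μ hp _ h0 hsupp a ha
    exact exists_isFunctionOf_enorm_le_dirichletNorm hp
      (fun ε hε => measure_Ioo_zero_ne_zero h0 hsupp hε) ha
  · intro p α hp hα
    have hp0 : 0 < p := by linarith
    obtain ⟨D, hD, hle⟩ := exists_dirichletEvalNorm_muAlpha_le hp hα
    -- The position of `α` relative to `p - 2` is that of the exponent `(2 + α)/p` relative to `1`.
    -- It is fixed before `c` is chosen, so the two other implications hold vacuously.
    rcases lt_trichotomy (p - 2) α with h | h | h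
    · have hβ : 1 < (2 + α) / p := by
        rw [lt_div_iff₀ hp0]
        linarith
      have hβ0 : 0 < (2 + α) / p - 1 := by linarith
      refine ⟨D * (1 + 1 / ((2 + α) / p - 1)), by positivity, fun s hs =>
        ⟨fun _ => (hle s hs).trans (ENNReal.ofReal_le_ofReal ?_), fun h' => by linarith,
          fun h' => by linarith⟩⟩
      have h1 := evalIntegral_le_of_one_lt hβ (δ := 2 * s.re - 1) (by linarith)
      have h2 := le_max_left 1 ((2 * s.re - 1) ^ (1 - (2 + α) / p))
      rw [mul_assoc]
      gcongr
      linarith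
    · have hβ : (2 + α) / p = 1 := by
        rw [div_eq_one_iff_eq hp0.ne']
        linarith
      refine ⟨D * (2 + Real.log 5), by positivity, fun s hs =>
        ⟨fun h' => by linarith, fun _ => (hle s hs).trans (ENNReal.ofReal_le_ofReal ?_),
          fun h' => by linarith⟩⟩
      have h1 := evalIntegral_one_le (δ := 2 * s.re - 1) (by linarith)
      have h2 := le_max_left 1 (Real.log (1 / (2 * s.re - 1)))
      rw [hβ, mul_assoc]
      gcongr
      linarith
    · have hβ : (2 + α) / p < 1 := by
        rw [div_lt_one hp0]
        linarith
      have hβ0 : 0 < 1 - (2 + α) / p := by linarith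
      refine ⟨D * (1 + 5 ^ (1 - (2 + α) / p) / (1 - (2 + α) / p)), by positivity, fun s hs =>
        ⟨fun h' => by linarith, fun h' => by linarith,
          fun _ => (hle s hs).trans (ENNReal.ofReal_le_ofReal ?_)⟩⟩
      gcongr
      exact evalIntegral_le_of_lt_one hβ (by linarith)
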